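/- Conventions. All locally convex spaces are real and Hausdorff. Let $E$, $F$ be locally convex spaces and $U\subseteq E$ open. A map $f\colon U\to F$ is $C^0$ if it is continuous; it is $C^{k+1}$ if it is continuous, the directional derivative $df(x,y)=\lim_{0\ne t\to 0}t^{-1}(f(x+ty)-f(x))$ exists for all $x\in U$, $y\in E$, and $df\colon U\times E\to F$ is $C^k$. It is smooth if it is $C^k$ for all $k\in\mathbb N$. Smooth manifolds modelled on a locally convex space, smooth maps between them, and Lie groups (groups which are smooth manifolds with smooth multiplication and inversion) are defined as usual via charts using this notion of smoothness. Let $\alpha\in\,]0,1]$. If $U\subseteq E$ is a neighbourhood of $x$, a map $f\colon U\to F$ is Hölder continuous of degree $\alpha$ at $x$ if for every continuous seminorm $q$ on $F$ there are $\delta>0$, $C>0$ and a continuous seminorm $p$ on $E$ such that $B^p_\delta(x)=\{y\in E: p(y-x)<\delta\}\subseteq U$ and $q(f(y)-f(x))\le C\,p(y-x)^\alpha$ for all $y\in B^p_\delta(x)$. If $U$ is open, $f\colon U\to F$ is Hölder continuous of degree $\alpha$ if for every $x_0\in U$ and every continuous seminorm $q$ on $F$ there are a continuous seminorm $p$ on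 $E$ and $\delta>0$ with $B^p_\delta(x_0)\subseteq U$ and $q(f(y)-f(x))\le p(y-x)^\alpha$ for all $x,y\in B^p_\delta(x_0)$. A map $f\colon M\to N$ between smooth manifolds is Hölder continuous of degree $\alpha$ at $x\in M$ if it is continuous at $x$ and there are charts $\phi\colon U_1\to U$ of $M$ around $x$ and $\psi\colon V_1\to V$ of $N$ around $f(x)$ such that $\psi\circ f\circ\phi^{-1}\colon\phi(f^{-1}(V_1)\cap U_1)\to V$ is Hölder continuous of degree $\alpha$ at $\phi(x)$. It is Hölder continuous of degree $\alpha$ if it is continuous and around each $x\in M$, respectively $f(x)$, there are charts $\phi$ and $\psi$ for which $\psi\circ f\circ\phi^{-1}$, with the domain just given, is Hölder continuous of degree $\alpha$. "Lipschitz continuous" (at a point) means Hölder continuous of degree $1$ (at that point). A sequence $(x_n)_{n\in\mathbb N}$ in $F$ is Mackey-Cauchy if there are a bounded set $B\subseteq F$ and real numbers $\mu_{n,m}$ with $x_n-x_m\in\mu_{n,m}B$ for all $n,m$ and $\mu_{n,m}\to0$ as both $n,m\to\infty$; $F$ is Mackey complete if every Mackey-Cauchy sequence in $F$ converges in $F$.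 Theorem. Let $f\colon G\to H$ be a homomorphism of groups between Lie groups modelled on locally convex spaces, and suppose that the modelling space of $H$ is Mackey complete. If $f$ is Hölder continuous of degree $\alpha$ at the identity $1\in G$ for some $\alpha\in\,]0,1]$, then $f$ is smooth. In particular, $f$ is smooth if it is Lipschitz continuous at $1$, and also if it is Lipschitz continuous. -/

import Mathlib

open Set Filter Topology
open scoped Pointwise

universe u v w

namespace Bastiani

section Calculus

/-- `IsCkOn k U f`: the restriction of `f` to the open set `U` is of class `C^k` in the sense of
Michal-Bastiani (Keller's `C^k_c`). `C^0` means continuous; `f` is `C^(k+1)` if `f` is continuous,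
all directional derivatives `df (x, y) = lim_{t → 0, t ≠ 0} t⁻¹ (f (x + t y) - f x)` with `x ∈ U`
and `y ∈ E` exist, and `df : U × E → F` is `C^k`. (Only the values of `df` on `U × E` matter.) -/
def IsCkOn {F : Type v} [AddCommGroup F] [Module ℝ F] [TopologicalSpace F] :
    ℕ → ∀ {E : Type u} [AddCommGroup E] [Module ℝ E] [TopologicalSpace E],
      Set E → (E → F) → Prop
  | 0, _, _, _, _, U, f => ContinuousOn f U
  | k + 1, E, _, _, _, U, f =>
      ContinuousOn f U ∧
        ∃ df : E × E → F,
          (∀ x ∈ U, ∀ y : E,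
            Tendsto (fun t : ℝ => t⁻¹ • (f (x + t • y) - f x)) (𝓝[≠] 0) (𝓝 (df (x, y)))) ∧
          IsCkOn k (U ×ˢ (univ : Set E)) df

variable {E : Type u} [AddCommGroup E] [Module ℝ E] [TopologicalSpace E]
variable {F : Type v} [AddCommGroup F] [Module ℝ F] [TopologicalSpace F]

/-- The restriction of `f` to the open set `U` is smooth, i.e. `C^k` for all `k`. -/
def IsSmoothOn (U : Set E) (f : E → F) : Prop :=
  ∀ k : ℕ, IsCkOn k U f

/-- The map `f` with domain `U` is Hölder continuous of degree `α` at the point `x`. -/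
def IsHolderAt (α : ℝ) (U : Set E) (f : E → F) (x : E) : Prop :=
  ∀ q : Seminorm ℝ F, Continuous q →
    ∃ δ : ℝ, 0 < δ ∧ ∃ C : ℝ, 0 < C ∧ ∃ p : Seminorm ℝ E, Continuous p ∧
      p.ball x δ ⊆ U ∧ ∀ y ∈ p.ball x δ, q (f y - f x) ≤ C * p (y - x) ^ α

/-- The map `f` with (open) domain `U` is Hölder continuous of degree `α`: locally, the Hölder
condition holds uniformly in both arguments. -/
def IsHolderOn (α : ℝ) (U : Set E) (f : E → F) : Prop :=
  ∀ x₀ ∈ U, ∀ q : Seminorm ℝ F, Continuous q →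
    ∃ p : Seminorm ℝ E, Continuous p ∧ ∃ δ : ℝ, 0 < δ ∧
      p.ball x₀ δ ⊆ U ∧
        ∀ x ∈ p.ball x₀ δ, ∀ y ∈ p.ball x₀ δ, q (f y - f x) ≤ p (y - x) ^ α

/-- A sequence `x` is Mackey-Cauchy if there are a bounded set `B` and real numbers `μ n m`,
tending to `0` as both `n, m → ∞`, such that `x n - x m ∈ μ n m • B` for all `n, m`. -/
def IsMackeyCauchy (x : ℕ → E) : Prop :=
  ∃ B : Set E, Bornology.IsVonNBounded ℝ B ∧ ∃ μ : ℕ → ℕ → ℝ,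
    (∀ n m : ℕ, x n - x m ∈ μ n m • B) ∧
      Tendsto (fun nm : ℕ × ℕ => μ nm.1 nm.2) (atTop ×ˢ atTop) (𝓝 0)

variable (E) in
/-- Every Mackey-Cauchy sequence converges. -/
def IsMackeyComplete : Prop :=
  ∀ x : ℕ → E, IsMackeyCauchy x → ∃ l : E, Tendsto x atTop (𝓝 l)

end Calculus

section Manifolds

/-- The domain `φ (f⁻¹(V₁) ∩ U₁)` of `f` in the local coordinates given by `φ : U₁ → U` and
`ψ : V₁ → V`. -/
def localDomain {X : Type*} {Y : Type*} {M : Type*} {N : Type*} [TopologicalSpace X]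
    [TopologicalSpace Y] [TopologicalSpace M] [TopologicalSpace N]
    (φ : OpenPartialHomeomorph M X) (ψ : OpenPartialHomeomorph N Y) (f : M → N) : Set X :=
  φ '' (f ⁻¹' ψ.source ∩ φ.source)

variable {E : Type u} [AddCommGroup E] [Module ℝ E] [TopologicalSpace E]
variable {F : Type v} [AddCommGroup F] [Module ℝ F] [TopologicalSpace F]
variable {M : Type*} [TopologicalSpace M] [ChartedSpace E M]
variable {N : Type*} [TopologicalSpace N] [ChartedSpace F N]

/-- `φ` belongs to the maximal smooth atlas: both transition maps between `φ` and any chart of the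
given atlas are smooth. -/
def IsChart (φ : OpenPartialHomeomorph M E) : Prop :=
  ∀ e ∈ atlas E M,
    IsSmoothOn (φ.symm.trans e).source (e ∘ φ.symm) ∧
      IsSmoothOn (e.symm.trans φ).source (φ ∘ e.symm)

variable (E M) in
/-- The atlas of the charted space `M` is a smooth atlas: all its transition maps are smooth. -/
def IsSmoothAtlas : Prop :=
  ∀ e ∈ atlas E M, IsChart (E := E) (M := M) e

variable (E F) in
/-- A map between smooth manifolds is smooth if it is continuous and smooth in all charts. -/
def IsSmoothMap (f : M → N) : Prop :=
  Continuous f ∧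
    ∀ (φ : OpenPartialHomeomorph M E) (ψ : OpenPartialHomeomorph N F), IsChart φ → IsChart ψ →
      IsSmoothOn (localDomain φ ψ f) (ψ ∘ f ∘ φ.symm)

variable (E F) in
/-- A map between smooth manifolds is Hölder continuous of degree `α` at `x` if it is continuous
at `x` and is so in suitable charts around `x` and `f x`. -/
def IsHolderMapAt (α : ℝ) (f : M → N) (x : M) : Prop :=
  ContinuousAt f x ∧
    ∃ (φ : OpenPartialHomeomorph M E) (ψ : OpenPartialHomeomorph N F), IsChart φ ∧ IsChart ψ ∧
      x ∈ φ.source ∧ f x ∈ ψ.source ∧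
        IsHolderAt α (localDomain φ ψ f) (ψ ∘ f ∘ φ.symm) (φ x)

variable (E F) in
/-- A map between smooth manifolds is Hölder continuous of degree `α` if it is continuous and,
around each point, it is so in suitable charts. -/
def IsHolderMap (α : ℝ) (f : M → N) : Prop :=
  Continuous f ∧ ∀ x : M,
    ∃ (φ : OpenPartialHomeomorph M E) (ψ : OpenPartialHomeomorph N F), IsChart φ ∧ IsChart ψ ∧
      x ∈ φ.source ∧ f x ∈ ψ.source ∧
        IsHolderOn α (localDomain φ ψ f) (ψ ∘ f ∘ φ.symm)

end Manifolds

/-- `G` is a smooth Lie group modelled on `E`: its atlas is a smooth atlas, and multiplication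
`G × G → G` and inversion `G → G` are smooth maps, i.e. continuous and smooth in all charts (where
`G × G` carries the product charts, with values in `E × E`). -/
structure IsLieGroup (E : Type u) [AddCommGroup E] [Module ℝ E] [TopologicalSpace E]
    (G : Type w) [Group G] [TopologicalSpace G] [ChartedSpace E G] : Prop where
  smooth_atlas : IsSmoothAtlas E G
  continuous_mul : Continuous (fun x : G × G => x.1 * x.2)
  smooth_mul : ∀ φ₁ φ₂ ψ : OpenPartialHomeomorph G E, IsChart φ₁ → IsChart φ₂ → IsChart ψ →
    IsSmoothOn (localDomain (φ₁.prod φ₂) ψ (fun x : G × G => x.1 * x.2))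
      (fun z : E × E => ψ (φ₁.symm z.1 * φ₂.symm z.2))
  smooth_inv : IsSmoothMap E E (fun x : G => x⁻¹)

end Bastiani

/-! In charts centred at the identities, `f` becomes a local homomorphism with `f 0 = 0` and `f x =
O(|x| ^ α)`. In a local Lie group the sum `x + y` is the product `x y` times an error `R = O(|(x,
y)| ^ 2)`, and a triple product is the sum of its factors up to second order. Applying `f` shows
that its additive defect is `O(|(x, y)| ^ (2 * α))` (`IsLocalLieGroup.isBigOPow_almost_additive`).

On the diagonal this bounds `f x - 2 f (x / 2)`. Iterating over dyadic scales turns such a bound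
with exponent below `1` into the same bound for `f` itself (`IsBigOPow.of_sub_two_smul`), so the
exponent of `f` can be doubled repeatedly until it is `3 / 4` (`IsBigOPow.improve`). The defect then
has order `3 / 2 > 1`, hence `2 ^ n f (x / 2 ^ n)` has geometrically small increments and converges
by Mackey completeness. Its limit `L` is continuous linear and `f - L = O(|x| ^ (3 / 2))`
(`exists_clm_of_almost_additive`); thus `f` is differentiable at `0`.

The identity `f x' = f x * f (x⁻¹ x')` moves this derivative to every point near `0` and expresses
`df` through `f`, `L` and smooth maps. So `C^k` implies `C^(k+1)`, and `f` is smooth near `0`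
(`IsLocalLieGroup.isSmoothNear_of_hom`). Translations carry smoothness to all of `G`. -/

namespace Bastiani

/-! ### Continuous seminorms, Hahn-Banach and mean value inequalities. -/

section Seminorms

variable {E : Type*} [AddCommGroup E] [Module ℝ E] [TopologicalSpace E] [IsTopologicalAddGroup E]
  [ContinuousSMul ℝ E] [LocallyConvexSpace ℝ E]

theorem tendsto_iff_seminorm {X : Type*} {l : Filter X} {u : X → E} {d : E} :
    Tendsto u l (𝓝 d) ↔
      ∀ q : Seminorm ℝ E, Continuous q → ∀ ε > 0, ∀ᶠ x in l, q (u x - d) < ε := by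
  rw [(PolynormableSpace.withSeminorms ℝ E).tendsto_nhds]
  exact ⟨fun h q hq => h ⟨q, hq⟩, fun h q => h q.1 q.2⟩

/-- Finite suprema and positive multiples of continuous seminorms are continuous, so one seminorm
with radius `1` suffices. -/
theorem exists_seminorm_ball_subset {s : Set E} (hs : s ∈ 𝓝 (0 : E)) :
    ∃ p : Seminorm ℝ E, Continuous p ∧ ∀ x, p x < 1 → x ∈ s := by
  obtain ⟨⟨i, r⟩, hr, h⟩ :=
    (PolynormableSpace.withSeminorms ℝ E).hasBasis_zero_ball.mem_iff.1 hs
  have hc : Continuous ⇑(i.sup fun p : {p : Seminorm ℝ E // Continuous p} => p.1) := by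
    clear h hr
    induction i using Finset.cons_induction with
    | empty => simpa using! continuous_const
    | cons a i _ ih => rw [Finset.sup_cons]; exact a.2.sup ih
  have hr' : 0 < r := hr
  refine ⟨Real.toNNReal r⁻¹ • i.sup (fun p => p.1), hc.const_smul _, fun x hx => h ?_⟩
  rw [Seminorm.mem_ball_zero]
  have hx' : r⁻¹ * (i.sup fun p : {p : Seminorm ℝ E // Continuous p} => p.1) x < 1 := by
    rwa [smul_apply, NNReal.smul_def, Real.coe_toNNReal _ (inv_pos.2 hr').le] at hx
  rwa [inv_mul_lt_iff₀ hr', mul_one] at hx'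

/-- Hahn-Banach, extending `c • v ↦ c * q v` from the line through `v`. It reduces estimates for
vector-valued curves to real-valued ones. -/
theorem exists_strongDual_eq_seminorm (q : Seminorm ℝ E) (hq : Continuous q) (v : E) :
    ∃ l : StrongDual ℝ E, l v = q v ∧ ∀ x, |l x| ≤ q x := by
  by_cases hv : v = 0
  · exact ⟨0, by simp [hv], fun x => by simp⟩
  obtain ⟨l, hl, hb⟩ := Module.Dual.exists_continuous_extension_of_le_seminorm_real
    (LinearPMap.mkSpanSingleton (K := ℝ) v (q v) hv).domain
    (LinearPMap.mkSpanSingleton (K := ℝ) v (q v) hv).toFun hq (by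
      rintro ⟨x, hx⟩
      obtain ⟨c, rfl⟩ := Submodule.mem_span_singleton.1 hx
      have := LinearPMap.mkSpanSingleton'_apply (R := ℝ) v (q v)
        (fun c hc => by
          simp [(smul_eq_zero.1 hc).resolve_right hv]) c hx
      refine le_trans (le_of_eq this) ?_
      rw [map_smul_eq_mul, smul_eq_mul]
      exact mul_le_mul_of_nonneg_right (le_abs_self c) (apply_nonneg q v))
  refine ⟨l, ?_, hb⟩
  have := hl ⟨v, Submodule.mem_span_singleton_self v⟩
  exact this.trans (LinearPMap.mkSpanSingleton_apply ℝ ℝ hv (q v))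

/-- The mean value inequality for curves in a locally convex space. -/
theorem seminorm_sub_le_of_deriv_le {γ γ' : ℝ → E} {q : Seminorm ℝ E} (hq : Continuous q) {C : ℝ}
    (hγ : ∀ s ∈ Icc (0 : ℝ) 1, Tendsto (fun t : ℝ => t⁻¹ • (γ (s + t) - γ s)) (𝓝[≠] 0) (𝓝 (γ' s)))
    (hC : ∀ s ∈ Icc (0 : ℝ) 1, q (γ' s) ≤ C) : q (γ 1 - γ 0) ≤ C := by
  obtain ⟨l, hl, hb⟩ := exists_strongDual_eq_seminorm q hq (γ 1 - γ 0)
  have hd : ∀ s ∈ Icc (0 : ℝ) 1, HasDerivAt (fun s => l (γ s)) (l (γ' s)) s := by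
    intro s hs
    rw [hasDerivAt_iff_tendsto_slope_zero]
    refine ((l.continuous.tendsto _).comp (hγ s hs)).congr fun t => ?_
    simp
  have := norm_image_sub_le_of_norm_deriv_le_segment_01' (fun s hs => (hd s hs).hasDerivWithinAt)
    (fun s hs => (hb _).trans (hC s (Ico_subset_Icc_self hs)))
  rw [← map_sub, hl] at this
  exact (le_abs_self _).trans this

theorem tendsto_mul_const_punctured {c : ℝ} (hc : c ≠ 0) :
    Tendsto (fun t : ℝ => t * c) (𝓝[≠] 0) (𝓝[≠] 0) := by
  refine tendsto_nhdsWithin_iff.2 ⟨?_, ?_⟩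
  · exact (Continuous.tendsto' (by fun_prop) 0 0 (by simp)).mono_left nhdsWithin_le_nhds
  · filter_upwards [self_mem_nhdsWithin] with t ht using mul_ne_zero ht hc

/-- Two derivatives: if `γ 0 = 0` and `γ' 0 = 0`, then `γ 1` is bounded by a bound for `γ''`. -/
theorem seminorm_le_of_deriv_deriv_le {γ γ' γ'' : ℝ → E} {q : Seminorm ℝ E} (hq : Continuous q)
    {C : ℝ}
    (hγ : ∀ s ∈ Icc (0 : ℝ) 1, Tendsto (fun t : ℝ => t⁻¹ • (γ (s + t) - γ s)) (𝓝[≠] 0) (𝓝 (γ' s)))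
    (hγ' : ∀ s ∈ Icc (0 : ℝ) 1,
      Tendsto (fun t : ℝ => t⁻¹ • (γ' (s + t) - γ' s)) (𝓝[≠] 0) (𝓝 (γ'' s)))
    (h0 : γ 0 = 0) (h0' : γ' 0 = 0)
    (hC : ∀ s ∈ Icc (0 : ℝ) 1, q (γ'' s) ≤ C) : q (γ 1) ≤ C := by
  have hC0 : 0 ≤ C := (apply_nonneg q _).trans (hC 0 (by simp))
  have key : ∀ s ∈ Icc (0 : ℝ) 1, q (γ' s) ≤ C := by
    intro s hs
    -- The segment from `0` to `s` is reparametrised to the unit interval; the factor `s ≤ 1` does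
    -- not increase the bound.
    have := seminorm_sub_le_of_deriv_le (γ := fun r => γ' (r * s)) (γ' := fun r => s • γ'' (r * s))
      hq (C := C) ?_ ?_
    · simpa [h0'] using this
    · intro r hr
      rcases eq_or_ne s 0 with rfl | hs0
      · simpa using! tendsto_const_nhds
      have hrs : r * s ∈ Icc (0 : ℝ) 1 := ⟨mul_nonneg hr.1 hs.1, mul_le_one₀ hr.2 hs.1 hs.2⟩
      refine (((hγ' _ hrs).comp (tendsto_mul_const_punctured hs0)).const_smul s).congr fun t => ?_
      simp only [Function.comp_apply, smul_smul, add_mul]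
      congr 1
      field_simp
    · intro r hr
      have hrs : r * s ∈ Icc (0 : ℝ) 1 := ⟨mul_nonneg hr.1 hs.1, mul_le_one₀ hr.2 hs.1 hs.2⟩
      rw [map_smul_eq_mul, Real.norm_of_nonneg hs.1]
      exact (mul_le_of_le_one_left (apply_nonneg q _) hs.2).trans (hC _ hrs)
  simpa [h0] using seminorm_sub_le_of_deriv_le hq hγ key

theorem isVonNBounded_of_seminorm {B : Set E}
    (h : ∀ q : Seminorm ℝ E, Continuous q → ∃ C, ∀ x ∈ B, q x ≤ C) :
    Bornology.IsVonNBounded ℝ B := by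
  rw [(PolynormableSpace.withSeminorms ℝ E).isVonNBounded_iff_seminorm_bounded]
  rintro ⟨q, hq⟩
  obtain ⟨C, hC⟩ := h q hq
  exact ⟨|C| + 1, by positivity, fun x hx => by
    have := hC x hx; have := le_abs_self C; change q x < _; linarith⟩

end Seminorms

/-! ### Power growth at the origin, measured by continuous seminorms. -/

section BigO

variable {E : Type*} [AddCommGroup E] [Module ℝ E] [TopologicalSpace E]
variable {F : Type*} [AddCommGroup F] [Module ℝ F] [TopologicalSpace F]
variable {F' : Type*} [AddCommGroup F'] [Module ℝ F'] [TopologicalSpace F']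

theorem eventually_seminorm_lt {p : Seminorm ℝ E} (hp : Continuous p) {r : ℝ} (hr : 0 < r) :
    ∀ᶠ x in 𝓝 (0 : E), p x < r :=
  hp.continuousAt.eventually_lt continuousAt_const (by simpa using hr)

theorem exists_seminorm_prod_le (q : Seminorm ℝ (E × F)) (hq : Continuous q) :
    ∃ (p₁ : Seminorm ℝ E) (p₂ : Seminorm ℝ F), Continuous p₁ ∧ Continuous p₂ ∧
      ∀ z, q z ≤ p₁ z.1 + p₂ z.2 := by
  refine ⟨q.comp (LinearMap.inl ℝ E F), q.comp (LinearMap.inr ℝ E F),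
    hq.comp (by simpa using! (by fun_prop : Continuous fun x : E => (x, (0 : F)))),
    hq.comp (by simpa using! (by fun_prop : Continuous fun x : F => ((0 : E), x))), fun z => ?_⟩
  simpa using map_add_le_add q (z.1, 0) (0, z.2)


/-- `g x = O(|x| ^ β)` as `x → 0`, with respect to all continuous seminorms. -/
def IsBigOPow (β : ℝ) (g : E → F) : Prop :=
  ∀ q : Seminorm ℝ F, Continuous q →
    ∃ p : Seminorm ℝ E, Continuous p ∧ ∀ x, p x < 1 → q (g x) ≤ p x ^ β

theorem exists_smul_seminorm {p : Seminorm ℝ E} (hp : Continuous p) (c : ℝ) (hc : 0 ≤ c) :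
    ∃ p' : Seminorm ℝ E, Continuous p' ∧ ∀ x, p' x = c * p x :=
  ⟨c.toNNReal • p, hp.const_smul _, fun _ => by
    rw [smul_apply, NNReal.smul_def, Real.coe_toNNReal _ hc, smul_eq_mul]⟩

/-- Both the radius and the constant are absorbed by rescaling the seminorm: a factor at least `δ⁻¹`
normalises the radius, and one at least `|C| ^ β⁻¹` removes the constant. -/
theorem IsBigOPow.of_le {β : ℝ} (hβ : 0 < β) {g : E → F}
    (h : ∀ q : Seminorm ℝ F, Continuous q → ∃ δ > 0, ∃ C : ℝ, ∃ p : Seminorm ℝ E, Continuous p ∧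
      ∀ x, p x < δ → q (g x) ≤ C * p x ^ β) : IsBigOPow β g := by
  intro q hq
  obtain ⟨δ, hδ, C, p, hp, H⟩ := h q hq
  obtain ⟨p', hp', e⟩ := exists_smul_seminorm hp (max (δ⁻¹) (|C| ^ β⁻¹)) (by positivity)
  refine ⟨p', hp', fun x hx => ?_⟩
  have h0 := apply_nonneg p x
  have h1 : δ⁻¹ * p x < 1 :=
    (mul_le_mul_of_nonneg_right (le_max_left _ _) h0).trans_lt (e x ▸ hx)
  have h2 : |C| ^ β⁻¹ * p x ≤ p' x := by
    rw [e]; exact mul_le_mul_of_nonneg_right (le_max_right _ _) h0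
  rw [inv_mul_lt_iff₀ hδ, mul_one] at h1
  calc q (g x) ≤ C * p x ^ β := H x h1
    _ ≤ |C| * p x ^ β := by gcongr; exact le_abs_self C
    _ = (|C| ^ β⁻¹ * p x) ^ β := by
      rw [Real.mul_rpow (by positivity) h0, Real.rpow_inv_rpow (abs_nonneg C) hβ.ne']
    _ ≤ p' x ^ β := by gcongr

theorem IsBigOPow.mono {α β : ℝ} (hα : 0 < α) (h : α ≤ β) {g : E → F} (hg : IsBigOPow β g) :
    IsBigOPow α g := by
  intro q hq
  obtain ⟨p, hp, H⟩ := hg q hq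
  refine ⟨p, hp, fun x hx => (H x hx).trans ?_⟩
  rcases (apply_nonneg p x).eq_or_lt with h0 | h0
  · rw [← h0, Real.zero_rpow hα.ne', Real.zero_rpow (hα.trans_le h).ne']
  · exact Real.rpow_le_rpow_of_exponent_ge h0 hx.le h

theorem IsBigOPow.comp {α β : ℝ} (hα : 0 < α) (hβ : 0 < β) {g : F → F'} {f : E → F}
    (hg : IsBigOPow β g) (hf : IsBigOPow α f) : IsBigOPow (α * β) (fun x => g (f x)) := by
  intro q hq
  obtain ⟨p, hp, H⟩ := hg q hq
  obtain ⟨p', hp', H'⟩ := hf p hp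
  refine ⟨p', hp', fun x hx => ?_⟩
  have h0 := apply_nonneg p' x
  have h1 : p (f x) < 1 := (H' x hx).trans_lt (Real.rpow_lt_one h0 hx hα)
  refine (H _ h1).trans ?_
  rw [Real.rpow_mul h0]
  exact Real.rpow_le_rpow (apply_nonneg p _) (H' x hx) hβ.le

theorem isBigOPow_continuousLinearMap (L : E →L[ℝ] F) : IsBigOPow 1 L := fun q hq =>
  ⟨q.comp L.toLinearMap, hq.comp L.continuous, fun x _ => by simp⟩

theorem IsBigOPow.comp_clm {α : ℝ} (hα : 0 < α) {g : F → F'} (hg : IsBigOPow α g) (L : E →L[ℝ] F) :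
    IsBigOPow α (fun x => g (L x)) := by
  simpa using hg.comp one_pos hα (isBigOPow_continuousLinearMap L)

theorem IsBigOPow.clm_comp {α : ℝ} (hα : 0 < α) (L : F →L[ℝ] F') {g : E → F}
    (hg : IsBigOPow α g) : IsBigOPow α (fun x => L (g x)) := by
  simpa using (isBigOPow_continuousLinearMap L).comp hα one_pos hg

theorem IsBigOPow.prodMk [IsTopologicalAddGroup F] [ContinuousSMul ℝ F] [LocallyConvexSpace ℝ F]
    {α : ℝ} (hα : 0 < α) {f : E → F} {g : E → F'}
    (hf : IsBigOPow α f) (hg : IsBigOPow α g) : IsBigOPow α (fun x => (f x, g x)) := by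
  refine .of_le hα fun q hq => ?_
  obtain ⟨q₁, q₂, h₁, h₂, hle⟩ := exists_seminorm_prod_le q hq
  obtain ⟨p₁, hp₁, H₁⟩ := hf q₁ h₁
  obtain ⟨p₂, hp₂, H₂⟩ := hg q₂ h₂
  refine ⟨1, one_pos, 2, p₁ ⊔ p₂, hp₁.sup hp₂, fun x hx => ?_⟩
  have hx' : max (p₁ x) (p₂ x) < 1 := hx
  have h1 := apply_nonneg p₁ x
  have h2 := apply_nonneg p₂ x
  calc q (f x, g x) ≤ q₁ (f x) + q₂ (g x) := hle _
    _ ≤ p₁ x ^ α + p₂ x ^ α :=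
      add_le_add (H₁ x ((le_max_left _ _).trans_lt hx')) (H₂ x ((le_max_right _ _).trans_lt hx'))
    _ ≤ max (p₁ x) (p₂ x) ^ α + max (p₁ x) (p₂ x) ^ α :=
      add_le_add (Real.rpow_le_rpow h1 (le_max_left _ _) hα.le)
        (Real.rpow_le_rpow h2 (le_max_right _ _) hα.le)
    _ = 2 * (p₁ ⊔ p₂) x ^ α := by rw [two_mul]; rfl

theorem IsBigOPow.congr [IsTopologicalAddGroup E] [ContinuousSMul ℝ E] [LocallyConvexSpace ℝ E]
    {α : ℝ} (hα : 0 < α) {f g : E → F} (hf : IsBigOPow α f) (h : f =ᶠ[𝓝 0] g) :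
    IsBigOPow α g := by
  refine .of_le hα fun q hq => ?_
  obtain ⟨p₁, hp₁, H₁⟩ := hf q hq
  obtain ⟨p₂, hp₂, H₂⟩ := exists_seminorm_ball_subset h
  refine ⟨1, one_pos, 1, p₁ ⊔ p₂, hp₁.sup hp₂, fun x hx => ?_⟩
  have hx' : max (p₁ x) (p₂ x) < 1 := hx
  have e : f x = g x := H₂ x ((le_max_right _ _).trans_lt hx')
  rw [← e, one_mul]
  exact (H₁ x ((le_max_left _ _).trans_lt hx')).trans
    (Real.rpow_le_rpow (apply_nonneg p₁ x) (le_max_left _ _) hα.le)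

variable [IsTopologicalAddGroup F] [ContinuousSMul ℝ F] [LocallyConvexSpace ℝ F]

theorem IsBigOPow.add {α : ℝ} (hα : 0 < α) {f g : E → F}
    (hf : IsBigOPow α f) (hg : IsBigOPow α g) : IsBigOPow α (fun x => f x + g x) :=
  (hf.prodMk hα hg).clm_comp hα (ContinuousLinearMap.fst ℝ F F + ContinuousLinearMap.snd ℝ F F)

theorem IsBigOPow.tendsto {α : ℝ} (hα : 0 < α) {f : E → F} (hf : IsBigOPow α f) :
    Tendsto f (𝓝 0) (𝓝 0) := by
  rw [tendsto_iff_seminorm]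
  intro q hq ε hε
  obtain ⟨p, hp, H⟩ := hf q hq
  have h1 : Tendsto (fun x => p x ^ α) (𝓝 0) (𝓝 0) := by
    have := (hp.tendsto 0).rpow_const (p := α) (Or.inr hα.le)
    rwa [map_zero, Real.zero_rpow hα.ne'] at this
  filter_upwards [h1.eventually_lt_const hε, eventually_seminorm_lt hp one_pos] with x h h'
  simpa using (H x h').trans_lt h

/-- If `h = O(|x| ^ β)` with `β > 1`, then `h` is differentiable at `0` with derivative `0`. -/
theorem IsBigOPow.tendsto_inv_smul {β : ℝ} (hβ : 1 < β) {h : E → F} (hh : IsBigOPow β h)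
    {X : Type*} {l : Filter X} {t : X → ℝ} {v : X → E} {v₀ : E} (ht : Tendsto t l (𝓝 0))
    (hv : Tendsto v l (𝓝 v₀)) : Tendsto (fun x => (t x)⁻¹ • h (t x • v x)) l (𝓝 0) := by
  rw [tendsto_iff_seminorm]
  intro q hq ε hε
  obtain ⟨p, hp, H⟩ := hh q hq
  have hpv : Tendsto (fun x => p (v x)) l (𝓝 (p v₀)) := (hp.tendsto v₀).comp hv
  have hta : Tendsto (fun x => |t x|) l (𝓝 0) := by simpa using ht.abs
  have h1 : Tendsto (fun x => |t x| * p (v x)) l (𝓝 0) := by simpa using hta.mul hpv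
  have h2 : Tendsto (fun x => |t x| ^ (β - 1) * p (v x) ^ β) l (𝓝 0) := by
    have e1 := hta.rpow_const (p := β - 1) (Or.inr (by linarith))
    rw [Real.zero_rpow (by linarith)] at e1
    simpa using e1.mul (hpv.rpow_const (p := β) (Or.inr (by linarith)))
  filter_upwards [h1.eventually_lt_const one_pos, h2.eventually_lt_const hε] with x hx1 hx2
  rcases eq_or_ne (t x) 0 with h0 | h0
  · simpa [h0] using hε
  have hpos : 0 < |t x| := abs_pos.2 h0
  have := H (t x • v x) (by rwa [map_smul_eq_mul, Real.norm_eq_abs])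
  rw [map_smul_eq_mul, Real.norm_eq_abs, Real.mul_rpow hpos.le (apply_nonneg p _)] at this
  rw [sub_zero, map_smul_eq_mul, norm_inv, Real.norm_eq_abs]
  refine lt_of_le_of_lt ?_ hx2
  rw [inv_mul_le_iff₀ hpos, Real.rpow_sub_one hpos.ne']
  refine this.trans (le_of_eq ?_)
  field_simp

end BigO

/-! ### Directional derivatives and the chain rule. -/

section DirDeriv

variable {E : Type*} [AddCommGroup E] [Module ℝ E]
variable {F : Type*} [AddCommGroup F] [Module ℝ F] [TopologicalSpace F]

/-- `d` is the derivative of `f` at `x` in the direction `y`. -/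
def HasDirDeriv (f : E → F) (x y : E) (d : F) : Prop :=
  Tendsto (fun t : ℝ => t⁻¹ • (f (x + t • y) - f x)) (𝓝[≠] 0) (𝓝 d)

theorem HasDirDeriv.unique [T2Space F] {f : E → F} {x y : E} {d d' : F}
    (h : HasDirDeriv f x y d) (h' : HasDirDeriv f x y d') : d = d' :=
  tendsto_nhds_unique h h'

theorem hasDirDeriv_zero (f : E → F) (x : E) : HasDirDeriv f x 0 0 := by
  simpa [HasDirDeriv] using! tendsto_const_nhds

theorem HasDirDeriv.smul [ContinuousConstSMul ℝ F] {f : E → F} {x y : E} {d : F}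
    (h : HasDirDeriv f x y d) (c : ℝ) : HasDirDeriv f x (c • y) (c • d) := by
  rcases eq_or_ne c 0 with rfl | hc
  · simpa using hasDirDeriv_zero f x
  refine (((h.comp (tendsto_mul_const_punctured hc))).const_smul c).congr fun t => ?_
  simp only [Function.comp_apply, smul_smul]
  congr 1
  field_simp

variable [TopologicalSpace E]

theorem HasDirDeriv.congr_nhds [ContinuousAdd E] [ContinuousSMul ℝ E] {f g : E → F} {x y : E}
    {d : F} (h : HasDirDeriv f x y d) (hfg : f =ᶠ[𝓝 x] g) : HasDirDeriv g x y d := by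
  have ht : Tendsto (fun t : ℝ => x + t • y) (𝓝[≠] 0) (𝓝 x) :=
    (Continuous.tendsto' (by fun_prop) _ _ (by simp)).mono_left nhdsWithin_le_nhds
  refine Tendsto.congr' ?_ h
  filter_upwards [ht.eventually hfg] with t h1
  rw [h1, hfg.eq_of_nhds]

/-- A map whose directional derivatives exist and are continuous is strictly differentiable. -/
theorem tendsto_slope_of_continuousAt [IsTopologicalAddGroup E] [ContinuousSMul ℝ E]
    [IsTopologicalAddGroup F] [ContinuousSMul ℝ F] [LocallyConvexSpace ℝ F]
    {U : Set E} (hU : IsOpen U) {f : E → F} {df : E × E → F}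
    (hd : ∀ x ∈ U, ∀ y, HasDirDeriv f x y (df (x, y))) {x v : E} (hx : x ∈ U)
    (hc : ContinuousAt df (x, v)) {X : Type*} {l : Filter X} {a b : X → E} {t : X → ℝ}
    (ha : Tendsto a l (𝓝 x)) (hb : Tendsto b l (𝓝 v)) (ht : Tendsto t l (𝓝[≠] 0)) :
    Tendsto (fun i => (t i)⁻¹ • (f (a i + t i • b i) - f (a i))) l (𝓝 (df (x, v))) := by
  rw [tendsto_iff_seminorm]
  intro q hq ε hε
  have h1 : Tendsto (fun w : (E × E) × ℝ => w.1.1 + w.2 • w.1.2) (𝓝 (x, v) ×ˢ 𝓝 0) (𝓝 x) := by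
    rw [← nhds_prod_eq]
    exact Continuous.tendsto' (by fun_prop) _ _ (by simp)
  have h2 : Tendsto (fun w : (E × E) × ℝ => q (df (w.1.1 + w.2 • w.1.2, w.1.2) - df (x, v)))
      (𝓝 (x, v) ×ˢ 𝓝 0) (𝓝 0) := by
    have h3 : Tendsto (fun w : (E × E) × ℝ => (w.1.1 + w.2 • w.1.2, w.1.2))
        (𝓝 (x, v) ×ˢ 𝓝 0) (𝓝 (x, v)) := by
      rw [← nhds_prod_eq]
      exact Continuous.tendsto' (by fun_prop) _ _ (by simp)
    have h4 := (hc.tendsto.comp h3).sub_const (df (x, v))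
    rw [sub_self] at h4
    have h5 := (hq.tendsto 0).comp h4
    rw [map_zero] at h5
    exact h5
  obtain ⟨Pa, hPa, Pb, hPb, H⟩ := eventually_prod_iff.1
    ((h1.eventually (hU.mem_nhds hx)).and (h2.eventually_lt_const (half_pos hε)))
  obtain ⟨δ, hδ, hball⟩ := Metric.eventually_nhds_iff.1 hPb
  have ht' := tendsto_nhdsWithin_iff.1 ht
  have hab := ha.prodMk_nhds hb
  filter_upwards [hab.eventually hPa, ht'.2, ht'.1.eventually (Metric.ball_mem_nhds 0 hδ)]
    with i hi hi0 hit
  have hi0' : t i ≠ 0 := hi0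
  have key : ∀ s ∈ Icc (0 : ℝ) 1, a i + (s * t i) • b i ∈ U ∧
      q (df (a i + (s * t i) • b i, b i) - df (x, v)) < ε / 2 := by
    intro s hs
    refine H hi (hball ?_)
    have : |t i| < δ := by simpa using hit
    rw [dist_zero_right, Real.norm_eq_abs, abs_mul, abs_of_nonneg hs.1]
    exact (mul_le_of_le_one_left (abs_nonneg _) hs.2).trans_lt this
  -- Along the segment from `a i` to `a i + t i • b i`, the linear part with slope `df (x, v)` is
  -- subtracted, so that the derivative of the curve is uniformly small.
  have := seminorm_sub_le_of_deriv_le hq (C := ε / 2)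
    (γ := fun s => (t i)⁻¹ • f (a i + (s * t i) • b i) - s • df (x, v))
    (γ' := fun s => df (a i + (s * t i) • b i, b i) - df (x, v)) ?_ (fun s hs => (key s hs).2.le)
  · refine lt_of_le_of_lt (le_of_eq ?_) (this.trans_lt (half_lt_self hε))
    congr 1
    simp only [one_mul, zero_mul, zero_smul, one_smul, add_zero, smul_sub]
    abel
  · intro s hs
    refine (((hd _ (key s hs).1 (b i)).comp
      (tendsto_mul_const_punctured hi0')).sub_const (df (x, v))).congr' ?_
    filter_upwards [self_mem_nhdsWithin] with r hr
    have hr' : r ≠ 0 := hr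
    simp only [Function.comp_apply, mul_inv, add_mul, add_smul, add_assoc, smul_sub, smul_add,
      smul_smul, inv_mul_cancel₀ hr', one_smul]
    rw [mul_comm r⁻¹ s]
    abel

/-- The difference quotient of `h` serves as a moving direction converging to `v`, which strict
differentiability of `f` permits. -/
theorem hasDirDeriv_comp [IsTopologicalAddGroup E] [ContinuousSMul ℝ E]
    [IsTopologicalAddGroup F] [ContinuousSMul ℝ F] [LocallyConvexSpace ℝ F]
    {D : Type*} [AddCommGroup D] [Module ℝ D]
    {U : Set E} (hU : IsOpen U) {f : E → F} {df : E × E → F}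
    (hd : ∀ x ∈ U, ∀ y, HasDirDeriv f x y (df (x, y))) {h : D → E} {x y : D} {v : E}
    (hx : h x ∈ U) (hc : ContinuousAt df (h x, v)) (hh : HasDirDeriv h x y v) :
    HasDirDeriv (fun z => f (h z)) x y (df (h x, v)) := by
  refine (tendsto_slope_of_continuousAt hU hd hx hc tendsto_const_nhds hh tendsto_id).congr' ?_
  filter_upwards [self_mem_nhdsWithin] with t ht
  have ht' : t ≠ 0 := ht
  simp only [id, smul_smul, mul_inv_cancel₀ ht', one_smul]
  rw [add_sub_cancel]

end DirDeriv

/-! ### Closure properties of `C^k` maps. -/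

section Calculus

theorem isCkOn_zero {E : Type u} [AddCommGroup E] [Module ℝ E] [TopologicalSpace E]
    {F : Type v} [AddCommGroup F] [Module ℝ F] [TopologicalSpace F] {U : Set E} {f : E → F} :
    IsCkOn 0 U f ↔ ContinuousOn f U := Iff.rfl

theorem IsCkOn.continuousOn {E : Type u} [AddCommGroup E] [Module ℝ E] [TopologicalSpace E]
    {F : Type v} [AddCommGroup F] [Module ℝ F] [TopologicalSpace F] {k : ℕ} {U : Set E}
    {f : E → F} (h : IsCkOn k U f) : ContinuousOn f U := by
  cases k with
  | zero => exact h
  | succ k => exact h.1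

variable {F : Type v} [AddCommGroup F] [Module ℝ F] [TopologicalSpace F]
variable {F' : Type w} [AddCommGroup F'] [Module ℝ F'] [TopologicalSpace F']

theorem IsCkOn.mono {k : ℕ} : ∀ {E : Type u} [AddCommGroup E] [Module ℝ E] [TopologicalSpace E]
    {U V : Set E} {f : E → F}, IsCkOn k U f → V ⊆ U → IsCkOn k V f := by
  induction k with
  | zero => intro E _ _ _ U V f h hV; exact ContinuousOn.mono h hV
  | succ k ih =>
    rintro E _ _ _ U V f ⟨hc, df, hd, hk⟩ hV
    exact ⟨hc.mono hV, df, fun x hx => hd x (hV hx), ih hk (prod_mono_left hV)⟩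

theorem IsCkOn.of_succ {k : ℕ} : ∀ {E : Type u} [AddCommGroup E] [Module ℝ E] [TopologicalSpace E]
    {U : Set E} {f : E → F}, IsCkOn (k + 1) U f → IsCkOn k U f := by
  induction k with
  | zero => intro E _ _ _ U f h; exact h.1
  | succ k ih =>
    rintro E _ _ _ U f ⟨hc, df, hd, hk⟩
    exact ⟨hc, df, hd, ih hk⟩

theorem IsCkOn.congr {k : ℕ} : ∀ {E : Type u} [AddCommGroup E] [Module ℝ E] [TopologicalSpace E]
    [ContinuousAdd E] [ContinuousSMul ℝ E]
    {U : Set E} {f g : E → F}, IsOpen U → IsCkOn k U f → EqOn f g U → IsCkOn k U g := by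
  induction k with
  | zero => intro E _ _ _ _ _ U f g _ h hfg; exact ContinuousOn.congr h hfg.symm
  | succ k ih =>
    rintro E _ _ _ _ _ U f g hU ⟨hc, df, hd, hk⟩ hfg
    exact ⟨hc.congr hfg.symm, df, fun x hx y =>
      HasDirDeriv.congr_nhds (hd x hx y) (hfg.eventuallyEq_of_mem (hU.mem_nhds hx)), hk⟩

/-- Being `C^k` is a local property. -/
theorem isCkOn_of_forall_exists [T2Space F] {k : ℕ} : ∀ {E : Type u} [AddCommGroup E] [Module ℝ E]
    [TopologicalSpace E] [ContinuousAdd E] [ContinuousSMul ℝ E] {U : Set E} {f : E → F},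
    (∀ x ∈ U, ∃ V, IsOpen V ∧ x ∈ V ∧ IsCkOn k V f) → IsCkOn k U f := by
  induction k with
  | zero =>
    intro E _ _ _ _ _ U f h x hx
    obtain ⟨V, hV, hxV, hc⟩ := h x hx
    exact ((isCkOn_zero.1 hc).continuousAt (hV.mem_nhds hxV)).continuousWithinAt
  | succ k ih =>
    intro E _ _ _ _ _ U f h
    refine ⟨fun x hx => ?_, ?_⟩
    · obtain ⟨V, hV, hxV, hc⟩ := h x hx
      exact (hc.1.continuousAt (hV.mem_nhds hxV)).continuousWithinAt
    classical
    -- Limits in `F` are unique, so the local derivatives agree on overlaps and glue to this single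
    -- function.
    let df : E × E → F := fun z =>
      if hz : ∃ d, HasDirDeriv f z.1 z.2 d then hz.choose else 0
    have hdf : ∀ x y d, HasDirDeriv f x y d → df (x, y) = d := by
      intro x y d hd
      have hz : ∃ d, HasDirDeriv f (x, y).1 (x, y).2 d := ⟨d, hd⟩
      simp only [df, dif_pos hz]
      exact hz.choose_spec.unique hd
    refine ⟨df, fun x hx y => ?_, ih fun z hz => ?_⟩
    · obtain ⟨V, hV, hxV, -, d, hd, -⟩ := h x hx
      have := hd x hxV y
      rwa [← hdf x y _ this] at this
    · obtain ⟨V, hV, hxV, -, d, hd, hk⟩ := h z.1 hz.1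
      refine ⟨V ×ˢ univ, hV.prod isOpen_univ, ⟨hxV, mem_univ _⟩,
        hk.congr (hV.prod isOpen_univ) fun w hw => ?_⟩
      exact (hdf w.1 w.2 _ (hd w.1 hw.1 w.2)).symm

theorem isCkOn_const {k : ℕ} (c : F) : ∀ {E : Type u} [AddCommGroup E] [Module ℝ E]
    [TopologicalSpace E] {U : Set E}, IsCkOn k U (fun _ => c) := by
  induction k generalizing c with
  | zero => intro E _ _ _ U; exact continuousOn_const
  | succ k ih =>
    intro E _ _ _ U
    refine ⟨continuousOn_const, fun _ => 0, fun x _ y => ?_, ih 0⟩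
    simpa using! tendsto_const_nhds

theorem IsCkOn.comp_affine {k : ℕ} : ∀ {E : Type u} [AddCommGroup E] [Module ℝ E]
    [TopologicalSpace E] [ContinuousAdd E] {D : Type w} [AddCommGroup D] [Module ℝ D]
    [TopologicalSpace D] {U : Set E} {f : E → F} (_ : IsCkOn k U f) (L : D →L[ℝ] E) (a : E),
    IsCkOn k ((fun x => L x + a) ⁻¹' U) (fun x => f (L x + a)) := by
  induction k with
  | zero =>
    intro E _ _ _ _ D _ _ _ U f hf L a
    exact ContinuousOn.comp (isCkOn_zero.1 hf) (by fun_prop) (mapsTo_preimage _ _)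
  | succ k ih =>
    rintro E _ _ _ _ D _ _ _ U f ⟨hc, df, hd, hk⟩ L a
    refine ⟨hc.comp (by fun_prop) (mapsTo_preimage _ _), fun z => df (L z.1 + a, L z.2),
      fun x hx y => ?_, ?_⟩
    · refine (hd _ hx (L y)).congr fun t => ?_
      dsimp only
      rw [map_add, map_smul, add_right_comm]
    · have h := (ih hk (L.prodMap L) (a, 0)).mono
        (V := ((fun x => L x + a) ⁻¹' U) ×ˢ univ) fun z hz => ⟨hz.1, mem_univ _⟩
      have e : (fun z : D × D => df (L z.1 + a, L z.2)) =
          fun z => df (L.prodMap L z + (a, 0)) := by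
        funext z
        congr 1
        ext <;> simp
      rwa [e]

theorem IsCkOn.affine_comp [ContinuousAdd F'] {k : ℕ} (L : F →L[ℝ] F') :
    ∀ {E : Type u} [AddCommGroup E] [Module ℝ E]
    [TopologicalSpace E] {U : Set E} {f : E → F} (_ : IsCkOn k U f) (b : F'),
    IsCkOn k U (fun x => L (f x) + b) := by
  induction k with
  | zero =>
    intro E _ _ _ U f hf b
    exact (L.continuous.comp_continuousOn (isCkOn_zero.1 hf)).add continuousOn_const
  | succ k ih =>
    rintro E _ _ _ U f ⟨hc, df, hd, hk⟩ b
    refine ⟨(L.continuous.comp_continuousOn hc).add continuousOn_const, fun z => L (df z),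
      fun x hx y => ?_, by simpa using ih hk 0⟩
    refine ((L.continuous.tendsto _).comp (hd x hx y)).congr fun t => ?_
    simp

theorem isCkOn_id {k : ℕ} : ∀ {E : Type u} [AddCommGroup E] [Module ℝ E]
    [TopologicalSpace E] [ContinuousAdd E], IsCkOn k univ (fun x : E => x) := by
  cases k with
  | zero => intro E _ _ _ _; exact continuousOn_id
  | succ k =>
    intro E _ _ _ _
    -- The derivative of the identity is a projection rather than an identity, so the induction has
    -- to run over all continuous linear maps into `E`.
    have key : ∀ k : ℕ, ∀ {D : Type u} [AddCommGroup D] [Module ℝ D] [TopologicalSpace D]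
        (L : D →L[ℝ] E), IsCkOn k univ L := by
      intro k
      induction k with
      | zero => intro D _ _ _ L; exact L.continuous.continuousOn
      | succ k ih =>
        intro D _ _ _ L
        refine ⟨L.continuous.continuousOn, fun z => L z.2, fun x _ y => ?_, ?_⟩
        · refine tendsto_const_nhds.congr' ?_
          filter_upwards [self_mem_nhdsWithin] with t ht
          have ht' : t ≠ 0 := ht
          simp [smul_smul, ht']
        · rw [univ_prod_univ]
          exact ih (L.comp (ContinuousLinearMap.snd ℝ D D))
    exact key _ (ContinuousLinearMap.id ℝ E)

theorem isCkOn_clm {k : ℕ} {E : Type u} [AddCommGroup E] [Module ℝ E]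
    [TopologicalSpace E] [ContinuousAdd E] [ContinuousAdd F] (L : E →L[ℝ] F) {U : Set E} :
    IsCkOn k U L := by
  simpa using ((isCkOn_id (k := k) (E := E)).mono (subset_univ U)).affine_comp L 0

theorem IsCkOn.prodMk {k : ℕ} : ∀ {E : Type u} [AddCommGroup E] [Module ℝ E]
    [TopologicalSpace E] {U : Set E} {f : E → F} {g : E → F'}, IsCkOn k U f → IsCkOn k U g →
    IsCkOn k U (fun x => (f x, g x)) := by
  induction k with
  | zero =>
    intro E _ _ _ U f g hf hg
    exact ContinuousOn.prodMk (isCkOn_zero.1 hf) (isCkOn_zero.1 hg)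
  | succ k ih =>
    rintro E _ _ _ U f g ⟨hc, df, hd, hk⟩ ⟨hc', dg, hd', hk'⟩
    exact ⟨hc.prodMk hc', fun z => (df z, dg z), fun x hx y =>
      (hd x hx y).prodMk_nhds (hd' x hx y), ih hk hk'⟩

/-- The derivative `dg (f z.1, df z)` is again a composite, of maps one order less regular but on
the spaces `E × E` and `F × F`; hence the induction quantifies over both spaces. -/
theorem IsCkOn.comp [IsTopologicalAddGroup F'] [ContinuousSMul ℝ F'] [LocallyConvexSpace ℝ F']
    {k : ℕ} : ∀ {E : Type u} [AddCommGroup E] [Module ℝ E] [TopologicalSpace E] [ContinuousAdd E]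
    {F : Type v} [AddCommGroup F] [Module ℝ F] [TopologicalSpace F] [IsTopologicalAddGroup F]
    [ContinuousSMul ℝ F] {U : Set E} {V : Set F} {f : E → F} {g : F → F'},
    IsOpen V → IsCkOn k V g → IsCkOn k U f → MapsTo f U V → IsCkOn k U (fun x => g (f x)) := by
  induction k with
  | zero =>
    intro E _ _ _ _ F _ _ _ _ _ U V f g _ hg hf hUV
    exact (isCkOn_zero.1 hg).comp (isCkOn_zero.1 hf) hUV
  | succ k ih =>
    rintro E _ _ _ _ F _ _ _ _ _ U V f g hV ⟨hgc, dg, hdg, hgk⟩ hf' hUV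
    obtain ⟨hfc, df, hdf, hfk⟩ := id hf'
    refine ⟨hgc.comp hfc hUV, fun z => dg (f z.1, df z), fun x hx y => ?_, ?_⟩
    · exact hasDirDeriv_comp hV hdg (hUV hx) (hgk.continuousOn.continuousAt
        ((hV.prod isOpen_univ).mem_nhds ⟨hUV hx, mem_univ _⟩)) (hdf x hx y)
    · have h1 : IsCkOn k (U ×ˢ univ) (fun z : E × E => f z.1) := by
        have := (IsCkOn.of_succ hf').comp_affine (ContinuousLinearMap.fst ℝ E E) 0
        simp only [add_zero, ContinuousLinearMap.coe_fst'] at this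
        exact this.mono fun z hz => hz.1
      exact ih (hV.prod isOpen_univ) hgk (h1.prodMk hfk) fun z hz => ⟨hUV hz.1, mem_univ _⟩

end Calculus

/-! ### Additivity of the derivative and second-order vanishing. -/

section SecondOrder

variable {E : Type u} [AddCommGroup E] [Module ℝ E] [TopologicalSpace E] [IsTopologicalAddGroup E]
  [ContinuousSMul ℝ E]
variable {F : Type v} [AddCommGroup F] [Module ℝ F] [TopologicalSpace F] [IsTopologicalAddGroup F]
  [ContinuousSMul ℝ F] [LocallyConvexSpace ℝ F] [T2Space F]

/-- The increment along `t • (v + w)` splits at `x + t • v`. The second piece has a moving base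
point, which strict differentiability handles. -/
theorem IsCkOn.hasDirDeriv_add {U : Set E} (hU : IsOpen U) {f : E → F} (hf : IsCkOn 1 U f) {x : E}
    (hx : x ∈ U) {v w : E} {dv dw : F} (hv : HasDirDeriv f x v dv) (hw : HasDirDeriv f x w dw) :
    HasDirDeriv f x (v + w) (dv + dw) := by
  obtain ⟨hc, df, hd, hk⟩ := hf
  have e : dw = df (x, w) := hw.unique (hd x hx w)
  have h1 : Tendsto (fun t : ℝ => x + t • v) (𝓝[≠] 0) (𝓝 x) :=
    (Continuous.tendsto' (by fun_prop) _ _ (by simp)).mono_left nhdsWithin_le_nhds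
  have h2 := tendsto_slope_of_continuousAt hU hd hx (v := w)
    ((isCkOn_zero.1 hk).continuousAt ((hU.prod isOpen_univ).mem_nhds ⟨hx, mem_univ _⟩))
    h1 tendsto_const_nhds tendsto_id
  rw [← e] at h2
  refine (hv.add h2).congr fun t => ?_
  rw [id, ← smul_add, smul_add t v w, add_assoc]
  congr 1
  abel

/-- A `C^2`-map which vanishes at `0` together with its derivative is `O(|x| ^ 2)`. -/
theorem IsCkOn.isBigOPow_two [LocallyConvexSpace ℝ E] {U : Set E} (hU : IsOpen U) (h0U : 0 ∈ U)
    {g : E → F} (hg : IsCkOn 2 U g) (h0 : g 0 = 0) (hd0 : ∀ v, HasDirDeriv g 0 v 0) :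
    IsBigOPow 2 g := by
  obtain ⟨hc, dg, hd, hc', d2, hd', hk⟩ := hg
  have hc2 : ContinuousOn d2 ((U ×ˢ univ) ×ˢ univ) := isCkOn_zero.1 hk
  have hO : IsOpen ((U ×ˢ (univ : Set E)) ×ˢ (univ : Set (E × E))) :=
    (hU.prod isOpen_univ).prod isOpen_univ
  have hd2 : ∀ x ∈ U, ∀ v w, Tendsto (fun t : ℝ => t⁻¹ • (dg (x + t • w, v) - dg (x, v)))
      (𝓝[≠] 0) (𝓝 (d2 ((x, v), (w, 0)))) := fun x hx v w => by
    simpa [HasDirDeriv] using hd' (x, v) ⟨hx, mem_univ _⟩ (w, 0)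
  have hom1 : ∀ x ∈ U, ∀ v (c : ℝ), dg (x, c • v) = c • dg (x, v) := fun x hx v c =>
    HasDirDeriv.unique (hd x hx (c • v)) (HasDirDeriv.smul (hd x hx v) c)
  have hxU : ∀ x ∈ U, ∀ w : E, ∀ᶠ t : ℝ in 𝓝[≠] 0, x + t • w ∈ U := fun x hx w =>
    ((Continuous.tendsto' (by fun_prop) _ _ (by simp) :
      Tendsto (fun t : ℝ => x + t • w) (𝓝 0) (𝓝 x)).mono_left nhdsWithin_le_nhds).eventually
      (hU.mem_nhds hx)
  -- The second derivative is quadratic on equal directions; this lets a bound by `1` near the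
  -- origin scale to a bound by `p z ^ 2`.
  have hom2 : ∀ x ∈ U, ∀ v (c : ℝ),
      d2 ((x, c • v), (c • v, 0)) = (c * c) • d2 ((x, v), (v, 0)) := by
    intro x hx v c
    have h1 : HasDirDeriv (fun x => dg (x, v)) x v (d2 ((x, v), (v, 0))) := hd2 x hx v v
    refine tendsto_nhds_unique (hd2 x hx (c • v) (c • v)) ?_
    rw [← smul_smul]
    refine ((h1.smul c).const_smul c).congr' ?_
    filter_upwards [hxU x hx (c • v)] with t ht
    rw [hom1 _ ht, hom1 _ hx, ← smul_sub, smul_comm c]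
  intro q hq
  have hD : ContinuousAt (fun z : E × E => q (d2 ((z.1, z.2), (z.2, 0)))) (0, 0) :=
    hq.continuousAt.comp (ContinuousAt.comp (f := fun z : E × E => ((z.1, z.2), (z.2, (0 : E))))
      (hc2.continuousAt (hO.mem_nhds ⟨⟨h0U, mem_univ _⟩, mem_univ _⟩))
      (by fun_prop))
  have hD0 : d2 (((0 : E), (0 : E)), ((0 : E), (0 : E))) = 0 := by
    simpa using hom2 0 h0U 0 0
  have hev : ∀ᶠ z : E × E in 𝓝 0, z.1 ∈ U ∧ q (d2 ((z.1, z.2), (z.2, 0))) < 1 := by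
    refine (continuous_fst.tendsto' (0 : E × E) 0 rfl |>.eventually (hU.mem_nhds h0U)).and ?_
    exact hD.eventually_lt continuousAt_const (by simp [hD0])
  rw [show (0 : E × E) = (0, 0) from rfl, nhds_prod_eq] at hev
  obtain ⟨A, hA, B, hB, hAB⟩ := eventually_prod_iff.1 hev
  obtain ⟨p, hp, hpAB⟩ := exists_seminorm_ball_subset (s := {x | A x ∧ B x}) (hA.and hB)
  refine ⟨p, hp, fun z hz => ?_⟩
  have hsz : ∀ s ∈ Icc (0 : ℝ) 1, p (s • z) < 1 := fun s hs => by
    rw [map_smul_eq_mul, Real.norm_of_nonneg hs.1]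
    exact (mul_le_of_le_one_left (apply_nonneg p z) hs.2).trans_lt hz
  have hszU : ∀ s ∈ Icc (0 : ℝ) 1, s • z ∈ U := fun s hs =>
    (hAB (hpAB _ (hsz s hs)).1 (hpAB _ hz).2).1
  have hdg0 : dg (0, z) = 0 := HasDirDeriv.unique (hd 0 h0U z) (hd0 z)
  rw [show (2 : ℝ) = ((2 : ℕ) : ℝ) by norm_num, Real.rpow_natCast]
  have main : q (g ((1 : ℝ) • z)) ≤ p z ^ 2 := by
    refine seminorm_le_of_deriv_deriv_le hq (γ := fun s => g (s • z)) (γ' := fun s => dg (s • z, z))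
      (γ'' := fun s => d2 ((s • z, z), (z, 0))) (fun s hs => ?_) (fun s hs => ?_)
      (by simpa using h0) (by simpa using hdg0) fun s hs => ?_
    · simp only [add_smul]
      exact hd _ (hszU s hs) z
    · simp only [add_smul]
      exact hd2 _ (hszU s hs) z z
    -- Rescaling by some `r > p z` and letting `r` decrease to `p z` also covers `p z = 0`, where
    -- division by `p z` is impossible.
    · have hle : ∀ r > p z, q (d2 ((s • z, z), (z, 0))) ≤ r ^ 2 := by
        intro r hr
        have hr0 : 0 < r := (apply_nonneg p z).trans_lt hr
        have h1 : p (r⁻¹ • z) < 1 := by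
          rw [map_smul_eq_mul, norm_inv, Real.norm_of_nonneg hr0.le, inv_mul_lt_iff₀ hr0, mul_one]
          exact hr
        have h2 := (hAB (hpAB _ (hsz s hs)).1 (hpAB _ h1).2).2
        rw [hom2 _ (hszU s hs), map_smul_eq_mul, Real.norm_of_nonneg (by positivity), ← mul_inv,
          inv_mul_lt_iff₀ (by positivity), mul_one, ← pow_two] at h2
        exact h2.le
      refine ge_of_tendsto (x := 𝓝[>] (p z)) (f := fun r : ℝ => r ^ 2) ?_ ?_
      · exact ((continuous_pow 2).tendsto (p z)).mono_left nhdsWithin_le_nhds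
      · filter_upwards [self_mem_nhdsWithin] with r hr using hle r hr
  rwa [one_smul] at main

end SecondOrder

/-! ### Almost additive maps: improving exponents and linearising. -/

section AlmostAdditive

variable {E : Type*} [AddCommGroup E] [Module ℝ E] [TopologicalSpace E]
variable {F : Type*} [AddCommGroup F] [Module ℝ F]

theorem seminorm_sub_le_geometric {a : ℕ → F} {r K : ℝ} (hr0 : 0 < r) (hr1 : r < 1)
    {q : Seminorm ℝ F} (h : ∀ n, q (a n - a (n + 1)) ≤ K * r ^ n) (n j : ℕ) :
    q (a n - a (n + j)) ≤ K / (1 - r) * r ^ n := by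
  have hK : 0 ≤ K := by simpa using (apply_nonneg q _).trans (h 0)
  have hr : 0 < 1 - r := by linarith
  -- Keeping the exact partial geometric sum makes the induction on `j` close.
  have key : q (a n - a (n + j)) ≤ K / (1 - r) * (r ^ n - r ^ (n + j)) := by
    induction j with
    | zero => simp
    | succ j ih =>
      have h1 : a n - a (n + (j + 1)) = (a n - a (n + j)) + (a (n + j) - a (n + j + 1)) := by
        rw [sub_add_sub_cancel, add_assoc]
      rw [h1]
      refine (map_add_le_add q _ _).trans ((add_le_add ih (h (n + j))).trans (le_of_eq ?_))
      rw [← add_assoc n j 1, pow_succ r (n + j)]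
      field_simp
      ring
  refine key.trans (mul_le_mul_of_nonneg_left ?_ (by positivity))
  linarith [pow_pos hr0 (n + j)]

variable [TopologicalSpace F]

/-- The additive defect is evaluated at the pair `(x / 2, x / 2)`. -/
theorem IsBigOPow.sub_two_smul {f : E → F} {β : ℝ} (hβ : 0 < β)
    [IsTopologicalAddGroup E] [ContinuousSMul ℝ E]
    (hA : IsBigOPow β fun z : E × E => f (z.1 + z.2) - f z.1 - f z.2) :
    IsBigOPow β fun x => f x - (2 : ℝ) • f ((1 / 2 : ℝ) • x) := by
  have := hA.comp_clm hβ (((1 / 2 : ℝ) • ContinuousLinearMap.id ℝ E).prod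
    ((1 / 2 : ℝ) • ContinuousLinearMap.id ℝ E))
  convert this using 2 with x
  have e : (1 / 2 : ℝ) • x + (1 / 2 : ℝ) • x = x := by
    rw [← add_smul]; norm_num
  simp only [ContinuousLinearMap.prod_apply, smul_apply, ContinuousLinearMap.id_apply, e, two_smul]
  abel

/-- If `f x - 2 f (x / 2) = O(|x| ^ β)` with `β < 1` and `f` is Hölder continuous at `0` with some
exponent, then it is so with exponent `β`. -/
theorem IsBigOPow.of_sub_two_smul {f : E → F} {α β : ℝ} (hα : 0 < α) (hβ : 0 < β) (hβ1 : β < 1)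
    (hf : IsBigOPow α f) (hD : IsBigOPow β fun x => f x - (2 : ℝ) • f ((1 / 2 : ℝ) • x)) :
    IsBigOPow β f := by
  refine .of_le hβ fun q hq => ?_
  obtain ⟨p₁, hp₁, H₁⟩ := hf q hq
  obtain ⟨p₂, hp₂, H₂⟩ := hD q hq
  set p := p₁ ⊔ p₂ with hpdef
  have hle1 : ∀ x, p₁ x ≤ p x := fun x => le_max_left (p₁ x) (p₂ x)
  have hle2 : ∀ x, p₂ x ≤ p x := fun x => le_max_right (p₁ x) (p₂ x)
  set s : ℝ := (1 / 2 : ℝ) ^ β with hs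
  have hs0 : 0 < s := by positivity
  have hs1 : s < 1 := Real.rpow_lt_one (by norm_num) (by norm_num) hβ
  have hs2 : 1 / 2 < s := by
    have := Real.rpow_lt_rpow_of_exponent_gt (x := 1 / 2) (by norm_num) (by norm_num) hβ1
    rwa [Real.rpow_one] at this
  have hsn : ∀ n : ℕ, ((1 / 2 : ℝ) ^ n) ^ β = s ^ n := fun n =>
    (Real.rpow_pow_comm (by norm_num) β n).symm
  -- Halving the argument gives the recursion `b (n + 1) ≤ (b n + s ^ n) / 2`. This `K` satisfies `K
  -- * s = 1 + K / 2`, so `K * s ^ n` dominates it; positivity of `K` uses `s > 1 / 2`, that is `β <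
  -- 1`.
  set K : ℝ := (s - 1 / 2)⁻¹ with hKdef
  have hs3 : 0 < s - 1 / 2 := by linarith
  have hK : 1 ≤ K := (one_le_inv₀ hs3).2 (by linarith)
  have hKs : K * (s - 1 / 2) = 1 := inv_mul_cancel₀ hs3.ne'
  have pow_le : ∀ (n : ℕ) (x : E), p ((1 / 2 : ℝ) ^ n • x) = (1 / 2) ^ n * p x := fun n x => by
    rw [map_smul_eq_mul, Real.norm_of_nonneg (by positivity)]
  have claim : ∀ (n : ℕ) (x : E), p x < 1 → q (f ((1 / 2 : ℝ) ^ n • x)) ≤ K * s ^ n := by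
    intro n x hx
    induction n with
    | zero =>
      simp only [pow_zero, one_smul, mul_one]
      refine (H₁ x ((hle1 x).trans_lt hx)).trans (le_trans ?_ hK)
      exact Real.rpow_le_one (apply_nonneg _ _) ((hle1 x).trans_lt hx).le hα.le
    | succ n ih =>
      set y : E := (1 / 2 : ℝ) ^ n • x with hy
      have hpy : p y ≤ (1 / 2) ^ n := by
        rw [pow_le]; exact mul_le_of_le_one_right (by positivity) hx.le
      have hpy1 : p y < 1 := by
        rw [pow_le]
        exact (mul_le_of_le_one_left (apply_nonneg p x)
          (pow_le_one₀ (by norm_num) (by norm_num))).trans_lt hx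
      have e : (1 / 2 : ℝ) ^ (n + 1) • x = (1 / 2 : ℝ) • y := by
        rw [hy, smul_smul, pow_succ']
      have h1 : q (f y - (2 : ℝ) • f ((1 / 2 : ℝ) • y)) ≤ s ^ n := by
        rw [← hsn]
        exact (H₂ y ((hle2 y).trans_lt hpy1)).trans
          (Real.rpow_le_rpow (apply_nonneg _ _) ((hle2 y).trans hpy) hβ.le)
      have h2 : 2 * q (f ((1 / 2 : ℝ) • y)) ≤ q (f y) + s ^ n := by
        have h3 : (2 : ℝ) • f ((1 / 2 : ℝ) • y) =
            f y - (f y - (2 : ℝ) • f ((1 / 2 : ℝ) • y)) := by abel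
        have h4 := map_sub_le_add q (f y) (f y - (2 : ℝ) • f ((1 / 2 : ℝ) • y))
        rw [← h3, map_smul_eq_mul, Real.norm_of_nonneg (by norm_num)] at h4
        linarith
      have h5 : K * s ^ (n + 1) = s ^ n + 1 / 2 * (K * s ^ n) := by
        rw [pow_succ]
        linear_combination s ^ n * hKs
      rw [e, h5]
      have : 0 < s ^ n := by positivity
      linarith
  have claim' : ∀ (n : ℕ) (x : E), p x < (1 / 2) ^ n → q (f x) ≤ K * s ^ n := by
    intro n x hx
    have h2 : (1 / 2 : ℝ) ^ n • ((1 / 2 : ℝ) ^ n)⁻¹ • x = x := smul_inv_smul₀ (by positivity) x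
    have := claim n (((1 / 2 : ℝ) ^ n)⁻¹ • x) (by
      rwa [map_smul_eq_mul, norm_inv, Real.norm_of_nonneg (by positivity),
        inv_mul_lt_iff₀ (by positivity), mul_one])
    rwa [h2] at this
  -- For `p x` lying between consecutive powers of `1 / 2`, passing from `(1 / 2) ^ n` to `p x`
  -- costs at most a factor `2`, hence `2 ^ β`.
  refine ⟨1, one_pos, K * 2 ^ β, p, hp₁.sup hp₂, fun x hx => ?_⟩
  rcases (apply_nonneg p x).eq_or_lt with h0 | h0
  · rw [← h0, Real.zero_rpow hβ.ne', mul_zero]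
    refine ge_of_tendsto' (x := atTop) (f := fun n : ℕ => K * s ^ n) ?_ fun n => claim' n x ?_
    · simpa using (tendsto_pow_atTop_nhds_zero_of_lt_one hs0.le hs1).const_mul K
    · rw [← h0]; positivity
  · obtain ⟨n, hn1, hn2⟩ := exists_nat_pow_near_of_lt_one (y := (1 / 2 : ℝ)) h0 hx.le
      (by norm_num) (by norm_num)
    rcases hn2.lt_or_eq with hn2 | hn2
    · refine (claim' n x hn2).trans ?_
      rw [mul_assoc, ← Real.mul_rpow (by norm_num) h0.le, ← hsn]
      refine mul_le_mul_of_nonneg_left (Real.rpow_le_rpow (by positivity) ?_ hβ.le) (by linarith)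
      rw [pow_succ] at hn1
      linarith
    -- If `p x` equals a power of `1 / 2`, the strict inequality in `claim'` requires the next
    -- larger scale; the power is not `1` because `p x < 1`.
    · rcases n with _ | n
      · simp at hn2; linarith
      refine (claim' n x ?_).trans ?_
      · rw [hn2, pow_succ]; linarith [pow_pos (show (0 : ℝ) < 1 / 2 by norm_num) n]
      rw [mul_assoc, ← Real.mul_rpow (by norm_num) h0.le, ← hsn]
      refine mul_le_mul_of_nonneg_left (Real.rpow_le_rpow (by positivity) ?_ hβ.le) (by linarith)
      rw [hn2, pow_succ]
      linarith

/-- Each round doubles the exponent, capped at `3 / 4`: the cap stays below `1`, as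
`of_sub_two_smul` requires, while its double exceeds `1`. -/
theorem IsBigOPow.improve {f : E → F} {α : ℝ} (hα : 0 < α) (hf : IsBigOPow α f)
    (hD : ∀ γ : ℝ, 0 < γ → IsBigOPow γ f →
      IsBigOPow (2 * γ) fun x => f x - (2 : ℝ) • f ((1 / 2 : ℝ) • x)) :
    IsBigOPow (3 / 4) f := by
  have key : ∀ n : ℕ, IsBigOPow (min (2 ^ n * α) (3 / 4)) f := by
    intro n
    induction n with
    | zero => exact hf.mono (by positivity) (by simp)
    | succ n ih =>
      have h0 : 0 < min (2 ^ n * α) (3 / 4) := by positivity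
      refine ih.of_sub_two_smul h0 (by positivity) ((min_le_right _ _).trans_lt (by norm_num)) ?_
      refine (hD _ h0 ih).mono (by positivity) ?_
      rw [pow_succ]
      rcases le_total (2 ^ n * α) (3 / 4) with h | h
      · rw [min_eq_left h]; exact (min_le_left _ _).trans (by linarith)
      · rw [min_eq_right h]; exact (min_le_right _ _).trans (by norm_num)
  obtain ⟨n, hn⟩ := pow_unbounded_of_one_lt (3 / 4 / α) (one_lt_two (α := ℝ))
  have := key n
  rwa [min_eq_right ((div_lt_iff₀ hα).1 hn).le] at this

variable [IsTopologicalAddGroup F] [ContinuousSMul ℝ F] [LocallyConvexSpace ℝ F]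

/-- The bounded set consists of all differences divided by `r ^ min n m`; the geometric estimate
bounds every continuous seminorm on it. -/
theorem isMackeyCauchy_of_geometric {a : ℕ → F} {r : ℝ} (hr0 : 0 < r) (hr1 : r < 1)
    (h : ∀ q : Seminorm ℝ F, Continuous q → ∃ K, ∀ n, q (a n - a (n + 1)) ≤ K * r ^ n) :
    IsMackeyCauchy a := by
  refine ⟨range fun nm : ℕ × ℕ => (r ^ min nm.1 nm.2)⁻¹ • (a nm.1 - a nm.2), ?_,
    fun n m => r ^ min n m, fun n m => ?_, ?_⟩
  · refine isVonNBounded_of_seminorm fun q hq => ?_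
    obtain ⟨K, hK⟩ := h q hq
    refine ⟨K / (1 - r), ?_⟩
    rintro _ ⟨⟨n, m⟩, rfl⟩
    have hle : q (a n - a m) ≤ K / (1 - r) * r ^ min n m := by
      rcases le_total n m with hnm | hnm
      · obtain ⟨j, rfl⟩ := Nat.exists_eq_add_of_le hnm
        simpa using seminorm_sub_le_geometric hr0 hr1 hK n j
      · obtain ⟨j, rfl⟩ := Nat.exists_eq_add_of_le hnm
        rw [← neg_sub, map_neg_eq_map]
        simpa using seminorm_sub_le_geometric hr0 hr1 hK m j
    dsimp only
    rw [map_smul_eq_mul, norm_inv, Real.norm_of_nonneg (by positivity),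
      inv_mul_le_iff₀ (by positivity), mul_comm]
    exact hle
  · exact ⟨_, ⟨(n, m), rfl⟩, smul_inv_smul₀ (by positivity) _⟩
  · refine (tendsto_pow_atTop_nhds_zero_of_lt_one hr0.le hr1).comp ?_
    refine tendsto_atTop.2 fun b => ?_
    filter_upwards [tendsto_fst.eventually_ge_atTop b, tendsto_snd.eventually_ge_atTop b]
      with nm h₁ h₂ using le_min h₁ h₂

variable [T2Space F]

/-- An almost additive map to a Mackey complete space is differentiable at `0`. -/
theorem exists_clm_of_almost_additive [IsTopologicalAddGroup E] [ContinuousSMul ℝ E]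
    (hF : IsMackeyComplete F) {f : E → F} {α β : ℝ} (hα : 0 < α) (hβ : 1 < β)
    (hf : IsBigOPow α f) (hA : IsBigOPow β fun z : E × E => f (z.1 + z.2) - f z.1 - f z.2) :
    ∃ L : E →L[ℝ] F, IsBigOPow β fun x => f x - L x := by
  have hβ0 : 0 < β := by linarith
  set D : E → F := fun x => f x - (2 : ℝ) • f ((1 / 2 : ℝ) • x) with hDdef
  have hD : IsBigOPow β D := hA.sub_two_smul hβ0
  set a : E → ℕ → F := fun x n => ((1 / 2 : ℝ) ^ n)⁻¹ • f ((1 / 2 : ℝ) ^ n • x) with ha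
  -- Each step doubles the outer factor and shrinks the error by `(1 / 2) ^ β`; the ratio is below
  -- `1` precisely because `β > 1`.
  set r : ℝ := 2 * (1 / 2) ^ β with hr
  have hr0 : 0 < r := by positivity
  have hr1 : r < 1 := by
    have := Real.rpow_lt_rpow_of_exponent_gt (x := 1 / 2) (by norm_num) (by norm_num) hβ
    rw [Real.rpow_one] at this
    linarith
  have hstep : ∀ x n, a x n - a x (n + 1) = ((1 / 2 : ℝ) ^ n)⁻¹ • D ((1 / 2 : ℝ) ^ n • x) := by
    intro x n
    simp only [ha, hDdef, smul_sub, smul_smul, pow_succ', mul_inv]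
    congr 2
    norm_num
    ring
  have hbound : ∀ (q : Seminorm ℝ F) (p : Seminorm ℝ E), (∀ x, p x < 1 → q (D x) ≤ p x ^ β) →
      ∀ x n, (1 / 2) ^ n * p x < 1 → q (a x n - a x (n + 1)) ≤ p x ^ β * r ^ n := by
    intro q p H x n hn
    have e : p ((1 / 2 : ℝ) ^ n • x) = (1 / 2) ^ n * p x := by
      rw [map_smul_eq_mul, Real.norm_of_nonneg (by positivity)]
    have h1 := H ((1 / 2 : ℝ) ^ n • x) (by rwa [e])
    rw [e, Real.mul_rpow (by positivity) (apply_nonneg p x),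
      ← Real.rpow_pow_comm (by norm_num)] at h1
    rw [hstep, map_smul_eq_mul, norm_inv, Real.norm_of_nonneg (by positivity),
      inv_mul_le_iff₀ (by positivity)]
    refine h1.trans (le_of_eq ?_)
    rw [hr, mul_pow, ← mul_assoc, ← mul_assoc, mul_comm ((1 / 2 : ℝ) ^ n), mul_assoc (p x ^ β),
      ← mul_pow]
    norm_num [mul_comm]
  have hconv : ∀ x, ∃ l, Tendsto (a x) atTop (𝓝 l) := by
    intro x
    refine hF _ (isMackeyCauchy_of_geometric hr0 hr1 fun q hq => ?_)
    obtain ⟨p, hp, H⟩ := hD q hq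
    have hev : ∀ᶠ n : ℕ in atTop, (1 / 2 : ℝ) ^ n * p x < 1 := by
      have := (tendsto_pow_atTop_nhds_zero_of_lt_one (r := (1 / 2 : ℝ)) (by norm_num)
        (by norm_num)).mul_const (p x)
      rw [zero_mul] at this
      exact this.eventually_lt_const one_pos
    -- The estimate is available only once `x / 2 ^ n` lies in the unit ball of `p`; the finitely
    -- many earlier terms are absorbed into the constant.
    have hb : IsBoundedUnder (· ≤ ·) atTop fun n => q (a x n - a x (n + 1)) / r ^ n := by
      refine ⟨p x ^ β, eventually_map.2 ?_⟩
      filter_upwards [hev] with n hn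
      rw [div_le_iff₀ (by positivity)]
      exact hbound q p H x n hn
    obtain ⟨K, hK⟩ := hb.bddAbove_range
    refine ⟨K, fun n => ?_⟩
    rw [← div_le_iff₀ (by positivity)]
    exact hK ⟨n, rfl⟩
  choose L hL using hconv
  have hadd : ∀ x y, L (x + y) = L x + L y := by
    intro x y
    -- The additive defect at `(x, y) / 2 ^ n`, multiplied by `2 ^ n`, vanishes in the limit since
    -- its order exceeds `1`.
    have h1 := hA.tendsto_inv_smul hβ (t := fun n : ℕ => (1 / 2 : ℝ) ^ n) (v := fun _ => (x, y))
      (tendsto_pow_atTop_nhds_zero_of_lt_one (by norm_num) (by norm_num)) tendsto_const_nhds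
    have h2 : Tendsto (fun n => a (x + y) n - a x n - a y n) atTop (𝓝 0) := by
      refine h1.congr fun n => ?_
      simp only [ha, Prod.smul_mk, smul_sub, smul_add]
    have h3 := tendsto_nhds_unique h2 (((hL (x + y)).sub (hL x)).sub (hL y))
    rw [sub_sub] at h3
    exact (sub_eq_zero.1 h3.symm)
  have hO : IsBigOPow β fun x => f x - L x := by
    refine .of_le hβ0 fun q hq => ?_
    obtain ⟨p, hp, H⟩ := hD q hq
    refine ⟨1, one_pos, (1 - r)⁻¹, p, hp, fun x hx => ?_⟩
    have hgeo : ∀ n, q (a x 0 - a x n) ≤ p x ^ β / (1 - r) := by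
      intro n
      have := seminorm_sub_le_geometric hr0 hr1 (fun n => hbound q p H x n
        ((mul_le_of_le_one_left (apply_nonneg p x)
          (pow_le_one₀ (by norm_num) (by norm_num))).trans_lt hx)) 0 n
      simpa using this
    have hlim : Tendsto (fun n => q (a x 0 - a x n)) atTop (𝓝 (q (a x 0 - L x))) :=
      (hq.tendsto _).comp ((hL x).const_sub _)
    have := le_of_tendsto' hlim hgeo
    rw [mul_comm, ← div_eq_mul_inv]
    simpa [ha] using this
  -- Both `f` and `f - L` tend to `0`, so `L` does; an additive map continuous at `0` is continuous,
  -- hence real-linear.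
  have hcont : ContinuousAt (AddMonoidHom.mk' L hadd) 0 := by
    have h1 : Tendsto L (𝓝 0) (𝓝 0) := by
      have := (hf.tendsto hα).sub (hO.tendsto hβ0)
      simpa using this
    have h0 : L 0 = 0 := by simpa using hadd 0 0
    rw [← h0] at h1
    exact h1
  exact ⟨(AddMonoidHom.mk' L hadd).toRealLinearMap (continuous_of_continuousAt_zero _ hcont), hO⟩

end AlmostAdditive

/-! ### Germs of smooth maps. -/

section SmoothNear

variable {E : Type u} [AddCommGroup E] [Module ℝ E] [TopologicalSpace E]
variable {F : Type v} [AddCommGroup F] [Module ℝ F] [TopologicalSpace F]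
variable {F' : Type w} [AddCommGroup F'] [Module ℝ F'] [TopologicalSpace F']

/-- `f` is smooth on some open neighbourhood of `x`. -/
def IsSmoothNear (f : E → F) (x : E) : Prop :=
  ∃ U : Set E, IsOpen U ∧ x ∈ U ∧ IsSmoothOn U f

theorem IsSmoothNear.continuousAt {f : E → F} {x : E} (h : IsSmoothNear f x) :
    ContinuousAt f x := by
  obtain ⟨U, hU, hx, hf⟩ := h
  exact (hf 0).continuousOn.continuousAt (hU.mem_nhds hx)

theorem IsSmoothNear.prodMk {f : E → F} {g : E → F'} {x : E} (hf : IsSmoothNear f x)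
    (hg : IsSmoothNear g x) : IsSmoothNear (fun z => (f z, g z)) x := by
  obtain ⟨U, hU, hxU, hf⟩ := hf
  obtain ⟨V, hV, hxV, hg⟩ := hg
  exact ⟨U ∩ V, hU.inter hV, ⟨hxU, hxV⟩, fun k =>
    ((hf k).mono inter_subset_left).prodMk ((hg k).mono inter_subset_right)⟩

theorem isSmoothNear_const (c : F) (x : E) : IsSmoothNear (fun _ => c) x :=
  ⟨univ, isOpen_univ, mem_univ _, fun _ => isCkOn_const c⟩

theorem isSmoothNear_clm [ContinuousAdd E] [ContinuousAdd F] (L : E →L[ℝ] F) (x : E) :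
    IsSmoothNear L x :=
  ⟨univ, isOpen_univ, mem_univ _, fun _ => isCkOn_clm L⟩

theorem isSmoothNear_fst [ContinuousAdd F] [ContinuousAdd F'] (x : F × F') :
    IsSmoothNear (fun z : F × F' => z.1) x :=
  isSmoothNear_clm (ContinuousLinearMap.fst ℝ F F') x

theorem isSmoothNear_snd [ContinuousAdd F] [ContinuousAdd F'] (x : F' × F) :
    IsSmoothNear (fun z : F' × F => z.2) x :=
  isSmoothNear_clm (ContinuousLinearMap.snd ℝ F' F) x

/-- Used with `L` a coordinate inclusion: a map vanishing on every axis has zero derivative along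
each, and additivity then gives zero derivative in all directions. -/
theorem hasDirDeriv_of_eventually_eq_zero {D : Type*} [AddCommGroup D] [Module ℝ D]
    [TopologicalSpace D] [ContinuousSMul ℝ D] {g : E → F} (L : D →L[ℝ] E)
    (h : ∀ᶠ x in 𝓝 (0 : D), g (L x) = 0) (v : D) : HasDirDeriv g 0 (L v) 0 := by
  have h0 : g 0 = 0 := by simpa using h.self_of_nhds
  have ht : Tendsto (fun t : ℝ => t • v) (𝓝[≠] 0) (𝓝 0) :=
    (Continuous.tendsto' (by fun_prop) _ _ (by simp)).mono_left nhdsWithin_le_nhds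
  refine tendsto_const_nhds.congr' ?_
  filter_upwards [ht.eventually h] with t h1
  rw [zero_add, ← map_smul, h1, h0, sub_zero, smul_zero]

theorem IsSmoothNear.congr [ContinuousAdd E] [ContinuousSMul ℝ E] {f g : E → F} {x : E}
    (hf : IsSmoothNear f x) (hfg : f =ᶠ[𝓝 x] g) : IsSmoothNear g x := by
  obtain ⟨U, hU, hxU, hf⟩ := hf
  obtain ⟨V, hV, hVo, hxV⟩ := mem_nhds_iff.1 hfg
  exact ⟨U ∩ V, hU.inter hVo, ⟨hxU, hxV⟩, fun k =>
    ((hf k).mono inter_subset_left).congr (hU.inter hVo) fun z hz => hV hz.2⟩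

theorem isSmoothOn_of_forall [ContinuousAdd E] [ContinuousSMul ℝ E] [T2Space F] {f : E → F}
    {U : Set E} (h : ∀ x ∈ U, IsSmoothNear f x) : IsSmoothOn U f := fun k =>
  isCkOn_of_forall_exists fun x hx =>
    let ⟨V, hV, hxV, hf⟩ := h x hx
    ⟨V, hV, hxV, hf k⟩

theorem IsSmoothNear.comp [ContinuousAdd E] [IsTopologicalAddGroup F] [ContinuousSMul ℝ F]
    [IsTopologicalAddGroup F'] [ContinuousSMul ℝ F'] [LocallyConvexSpace ℝ F']
    {g : F → F'} {f : E → F} {x : E} (hg : IsSmoothNear g (f x)) (hf : IsSmoothNear f x) :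
    IsSmoothNear (fun z => g (f z)) x := by
  obtain ⟨U, hU, hxU, hf⟩ := hf
  obtain ⟨V, hV, hxV, hg⟩ := hg
  exact ⟨U ∩ f ⁻¹' V, (hf 0).continuousOn.isOpen_inter_preimage hU hV, ⟨hxU, hxV⟩, fun k =>
    (hg k).comp hV ((hf k).mono inter_subset_left) fun z hz => hz.2⟩

theorem IsSmoothNear.comp_of_eq [ContinuousAdd E] [IsTopologicalAddGroup F] [ContinuousSMul ℝ F]
    [IsTopologicalAddGroup F'] [ContinuousSMul ℝ F'] [LocallyConvexSpace ℝ F']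
    {g : F → F'} {f : E → F} {x : E} {y : F} (hg : IsSmoothNear g y) (hf : IsSmoothNear f x)
    (hy : f x = y) : IsSmoothNear (fun z => g (f z)) x := by
  subst hy
  exact hg.comp hf

theorem isSmoothNear_id [ContinuousAdd E] (x : E) : IsSmoothNear (fun z => z) x :=
  isSmoothNear_clm (ContinuousLinearMap.id ℝ E) x

variable [IsTopologicalAddGroup F] [ContinuousSMul ℝ F] [LocallyConvexSpace ℝ F]

theorem IsSmoothNear.add [ContinuousAdd E] {f g : E → F} {x : E} (hf : IsSmoothNear f x)
    (hg : IsSmoothNear g x) : IsSmoothNear (fun z => f z + g z) x :=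
  (isSmoothNear_clm (ContinuousLinearMap.fst ℝ F F + ContinuousLinearMap.snd ℝ F F) _).comp
    (hf.prodMk hg)

theorem IsSmoothNear.sub [ContinuousAdd E] {f g : E → F} {x : E} (hf : IsSmoothNear f x)
    (hg : IsSmoothNear g x) : IsSmoothNear (fun z => f z - g z) x :=
  (isSmoothNear_clm (ContinuousLinearMap.fst ℝ F F - ContinuousLinearMap.snd ℝ F F) _).comp
    (hf.prodMk hg)

theorem IsSmoothNear.isBigOPow_two [IsTopologicalAddGroup E] [ContinuousSMul ℝ E]
    [LocallyConvexSpace ℝ E] [T2Space F] {g : E → F} (hg : IsSmoothNear g 0) (h0 : g 0 = 0)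
    (hd0 : ∀ v, HasDirDeriv g 0 v 0) : IsBigOPow 2 g :=
  let ⟨_, hU, h0U, hg⟩ := hg
  (hg 2).isBigOPow_two hU h0U h0 hd0

theorem IsSmoothNear.hasDirDeriv_add [IsTopologicalAddGroup E] [ContinuousSMul ℝ E]
    [T2Space F] {f : E → F} {x v w : E} {dv dw : F} (hf : IsSmoothNear f x)
    (hv : HasDirDeriv f x v dv) (hw : HasDirDeriv f x w dw) :
    HasDirDeriv f x (v + w) (dv + dw) :=
  let ⟨_, hU, hxU, hf⟩ := hf
  (hf 1).hasDirDeriv_add hU hxU hv hw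

end SmoothNear

/-! ### Local Lie groups and their homomorphisms. -/

section LocalGroup

/-- A local Lie group structure near the origin of a locally convex space, with multiplication `m`,
inversion `ι` and neutral element `0`. -/
structure IsLocalLieGroup {E : Type u} [AddCommGroup E] [Module ℝ E] [TopologicalSpace E]
    (m : E × E → E) (ι : E → E) : Prop where
  smooth_mul : IsSmoothNear m 0
  smooth_inv : IsSmoothNear ι 0
  inv_zero : ι 0 = 0
  mul_zero : ∀ᶠ x in 𝓝 (0 : E), m (x, 0) = x
  zero_mul : ∀ᶠ x in 𝓝 (0 : E), m (0, x) = x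
  inv_mul : ∀ᶠ x in 𝓝 (0 : E), m (ι x, x) = 0
  mul_inv : ∀ᶠ x in 𝓝 (0 : E), m (x, ι x) = 0
  assoc : ∀ᶠ z : (E × E) × E in 𝓝 0, m (m z.1, z.2) = m (z.1.1, m (z.1.2, z.2))

variable {E : Type u} [AddCommGroup E] [Module ℝ E] [TopologicalSpace E]

namespace IsLocalLieGroup

variable {m : E × E → E} {ι : E → E} (h : IsLocalLieGroup m ι)
include h

theorem mul_zero_zero : m 0 = 0 := h.mul_zero.self_of_nhds

theorem tendsto_mul : Tendsto m (𝓝 0) (𝓝 0) := by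
  have := h.smooth_mul.continuousAt.tendsto
  rwa [h.mul_zero_zero] at this

theorem tendsto_inv : Tendsto ι (𝓝 0) (𝓝 0) := by
  have := h.smooth_inv.continuousAt.tendsto
  rwa [h.inv_zero] at this

/-- Cancellation recovers `x + y` from `x y` and the error factor, and later `x'` from `x` and `x⁻¹
x'`. -/
theorem mul_inv_mul : ∀ᶠ z : E × E in 𝓝 0, m (z.1, m (ι z.1, z.2)) = z.2 := by
  have t1 : Tendsto (fun z : E × E => z.1) (𝓝 0) (𝓝 0) := continuous_fst.tendsto' _ _ rfl
  have t2 : Tendsto (fun z : E × E => z.2) (𝓝 0) (𝓝 0) := continuous_snd.tendsto' _ _ rfl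
  have t3 : Tendsto (fun z : E × E => ((z.1, ι z.1), z.2)) (𝓝 0) (𝓝 0) :=
    (t1.prodMk_nhds (h.tendsto_inv.comp t1)).prodMk_nhds t2
  filter_upwards [t3.eventually h.assoc, t1.eventually h.mul_inv, t2.eventually h.zero_mul]
    with z e1 e2 e3
  rw [← e1, e2, e3]

variable [IsTopologicalAddGroup E] [ContinuousSMul ℝ E] [LocallyConvexSpace ℝ E]

theorem smooth_inv_mul : IsSmoothNear (fun z : E × E => m (ι z.1, z.2)) 0 := by
  refine IsSmoothNear.comp_of_eq (f := fun z : E × E => (ι z.1, z.2)) h.smooth_mul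
    (IsSmoothNear.prodMk (IsSmoothNear.comp h.smooth_inv (isSmoothNear_fst _))
      (isSmoothNear_snd _)) (by simp [h.inv_zero])

theorem tendsto_inv_mul : Tendsto (fun z : E × E => m (ι z.1, z.2)) (𝓝 0) (𝓝 0) := by
  have := h.smooth_inv_mul.continuousAt.tendsto
  simpa [h.inv_zero, show m (0, 0) = 0 from h.mul_zero_zero] using this

variable [T2Space E]

/-- Addition agrees with the multiplication up to an error term of second order. -/
theorem isBigOPow_two_error :
    IsBigOPow 2 (fun z : E × E => m (ι (m z), z.1 + z.2)) := by
  have h00 : m (0, 0) = 0 := h.mul_zero_zero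
  have hs : IsSmoothNear (fun z : E × E => m (ι (m z), z.1 + z.2)) 0 := by
    refine IsSmoothNear.comp_of_eq (f := fun z : E × E => (m z, z.1 + z.2)) h.smooth_inv_mul
      (h.smooth_mul.prodMk ((isSmoothNear_fst _).add (isSmoothNear_snd _)))
      (by simp [h.mul_zero_zero])
  refine hs.isBigOPow_two (by simp [h00, h.mul_zero_zero, h.inv_zero]) fun v => ?_
  have h1 := hasDirDeriv_of_eventually_eq_zero (g := fun z : E × E => m (ι (m z), z.1 + z.2))
    (ContinuousLinearMap.inl ℝ E E) (by
      filter_upwards [h.mul_zero, h.inv_mul] with x e1 e2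
      simp [e1, e2]) v.1
  have h2 := hasDirDeriv_of_eventually_eq_zero (g := fun z : E × E => m (ι (m z), z.1 + z.2))
    (ContinuousLinearMap.inr ℝ E E) (by
      filter_upwards [h.zero_mul, h.inv_mul] with x e1 e2
      simp [e1, e2]) v.2
  simpa using hs.hasDirDeriv_add h1 h2

/-- The triple product agrees with the sum up to an error term of second order. -/
theorem isBigOPow_two_triple :
    IsBigOPow 2 (fun z : (E × E) × E => m (m z.1, z.2) - z.1.1 - z.1.2 - z.2) := by
  have h00 : m (0, 0) = 0 := h.mul_zero_zero
  have s1 : IsSmoothNear (fun z : (E × E) × E => z.1) 0 := isSmoothNear_fst _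
  have s2 : IsSmoothNear (fun z : (E × E) × E => z.2) 0 := isSmoothNear_snd _
  have s11 : IsSmoothNear (fun z : (E × E) × E => z.1.1) 0 :=
    IsSmoothNear.comp (isSmoothNear_fst _) s1
  have s12 : IsSmoothNear (fun z : (E × E) × E => z.1.2) 0 :=
    IsSmoothNear.comp (isSmoothNear_snd _) s1
  have s3 : IsSmoothNear (fun z : (E × E) × E => m (m z.1, z.2)) 0 := by
    refine IsSmoothNear.comp_of_eq (f := fun z : (E × E) × E => (m z.1, z.2)) h.smooth_mul
      (IsSmoothNear.prodMk (IsSmoothNear.comp h.smooth_mul s1) s2) (by simp [h.mul_zero_zero])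
  have hs := ((s3.sub s11).sub s12).sub s2
  refine hs.isBigOPow_two (by simp [h00, h.mul_zero_zero]) fun v => ?_
  have h1 := hasDirDeriv_of_eventually_eq_zero
    (g := fun z : (E × E) × E => m (m z.1, z.2) - z.1.1 - z.1.2 - z.2)
    ((ContinuousLinearMap.inl ℝ (E × E) E).comp (ContinuousLinearMap.inl ℝ E E)) (by
      filter_upwards [h.mul_zero] with x e1
      simp [e1]) v.1.1
  have h2 := hasDirDeriv_of_eventually_eq_zero
    (g := fun z : (E × E) × E => m (m z.1, z.2) - z.1.1 - z.1.2 - z.2)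
    ((ContinuousLinearMap.inl ℝ (E × E) E).comp (ContinuousLinearMap.inr ℝ E E)) (by
      filter_upwards [h.mul_zero, h.zero_mul] with x e1 e2
      simp [e1, e2]) v.1.2
  have h3 := hasDirDeriv_of_eventually_eq_zero
    (g := fun z : (E × E) × E => m (m z.1, z.2) - z.1.1 - z.1.2 - z.2)
    (ContinuousLinearMap.inr ℝ (E × E) E) (by
      filter_upwards [h.zero_mul] with x e1
      simp [h.mul_zero_zero, e1]) v.2
  simpa using hs.hasDirDeriv_add (hs.hasDirDeriv_add h1 h2) h3

end IsLocalLieGroup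

variable [IsTopologicalAddGroup E] [ContinuousSMul ℝ E] [LocallyConvexSpace ℝ E]
variable {F : Type v} [AddCommGroup F] [Module ℝ F] [TopologicalSpace F] [IsTopologicalAddGroup F]
  [ContinuousSMul ℝ F] [LocallyConvexSpace ℝ F]
variable {m : E × E → E} {ι : E → E} {m' : F × F → F} {ι' : F → F} {f : E → F}

/-- With `x + y = (x y) R`, the image is the triple product of `f x`, `f y` and `f R`. The defect is
therefore `f R` plus the triple-product error, and both have order `2 * α`: the first since `R` is
quadratic, the second since the error is quadratic in terms of order `α`. -/
theorem IsLocalLieGroup.isBigOPow_almost_additive [T2Space E] [T2Space F] (h : IsLocalLieGroup m ι)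
    (h' : IsLocalLieGroup m' ι') (hf : ∀ᶠ z : E × E in 𝓝 0, f (m z) = m' (f z.1, f z.2))
    {α : ℝ} (hα : 0 < α) (hO : IsBigOPow α f) :
    IsBigOPow (2 * α) fun z : E × E => f (z.1 + z.2) - f z.1 - f z.2 := by
  have h2α : 0 < 2 * α := by positivity
  have hfR := hO.comp (f := fun z : E × E => m (ι (m z), z.1 + z.2)) two_pos hα
    h.isBigOPow_two_error
  have hT := h'.isBigOPow_two_triple.comp hα two_pos
    (((hO.comp_clm hα (ContinuousLinearMap.fst ℝ E E)).prodMk hα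
      (hO.comp_clm hα (ContinuousLinearMap.snd ℝ E E))).prodMk hα (hfR.mono hα (by linarith)))
  rw [mul_comm α 2] at hT
  refine (hT.add h2α hfR).congr h2α ?_
  have t1 : Tendsto (fun z : E × E => (m z, z.1 + z.2)) (𝓝 0) (𝓝 0) :=
    h.tendsto_mul.prodMk_nhds (Continuous.tendsto' (by fun_prop) _ _ (by simp))
  have t2 : Tendsto (fun z : E × E => (m z, m (ι (m z), z.1 + z.2))) (𝓝 0) (𝓝 0) :=
    h.tendsto_mul.prodMk_nhds (h.tendsto_inv_mul.comp t1)
  filter_upwards [hf, t1.eventually h.mul_inv_mul, t2.eventually hf] with z e1 e2 e3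
  rw [e2, e1] at e3
  simp only [ContinuousLinearMap.coe_fst', ContinuousLinearMap.coe_snd']
  rw [← e3]
  abel

/-- A local homomorphism which is differentiable at `0` is smooth near `0`. -/
theorem IsLocalLieGroup.isSmoothNear_of_hom (h : IsLocalLieGroup m ι)
    (h' : IsLocalLieGroup m' ι') (hf0 : f 0 = 0) (hfc : ContinuousAt f 0)
    (hf : ∀ᶠ z : E × E in 𝓝 0, f (m z) = m' (f z.1, f z.2))
    {β : ℝ} (hβ : 1 < β) {L : E →L[ℝ] F} (hL : IsBigOPow β fun x => f x - L x) :
    IsSmoothNear f 0 := by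
  -- `κ (x, x')` is `x⁻¹ x'`, which vanishes at `x' = x`; only the behaviour of `f` at `0` is then
  -- needed at every base point.
  set κ : E × E → E := fun z => m (ι z.1, z.2) with hκ
  obtain ⟨W, hW, h0W, hκs⟩ : IsSmoothNear κ 0 := h.smooth_inv_mul
  obtain ⟨W', hW', h0W', hm's⟩ := h'.smooth_mul
  have hfc0 : Tendsto f (𝓝 0) (𝓝 0) := by simpa [hf0] using hfc.tendsto
  have htrans : ∀ᶠ z : E × E in 𝓝 0, f z.2 = m' (f z.1, f (κ z)) := by
    have t : Tendsto (fun z : E × E => (z.1, κ z)) (𝓝 0) (𝓝 0) :=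
      (continuous_fst.tendsto' _ _ rfl).prodMk_nhds h.tendsto_inv_mul
    filter_upwards [h.mul_inv_mul, t.eventually hf] with z e1 e2
    rw [← e2]
    exact congrArg f e1.symm
  have tdiag : Tendsto (fun x : E => (x, x)) (𝓝 0) (𝓝 (0 : E × E)) := 
    tendsto_id.prodMk_nhds tendsto_id
  have tf : Tendsto (fun x : E => (f x, (0 : F))) (𝓝 0) (𝓝 (0 : F × F)) :=
    hfc0.prodMk_nhds tendsto_const_nhds
  obtain ⟨U, hUP, hU, h0U⟩ := mem_nhds_iff.1
    ((tdiag.eventually (hW.mem_nhds h0W)).and ((h.inv_mul).and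
      ((tf.eventually (hW'.mem_nhds h0W')).and (tdiag.eventually htrans.eventually_nhds))))
  have hWU : ∀ x ∈ U, (x, x) ∈ W := fun x hx => (hUP hx).1
  have hκ0 : ∀ x ∈ U, κ (x, x) = 0 := fun x hx => (hUP hx).2.1
  have hW'U : ∀ x ∈ U, (f x, (0 : F)) ∈ W' := fun x hx => (hUP hx).2.2.1
  have heq : ∀ x ∈ U, (fun x' => m' (f x, f (κ (x, x')))) =ᶠ[𝓝 x] f := fun x hx => by
    have t : Tendsto (fun x' : E => (x, x')) (𝓝 x) (𝓝 (x, x)) :=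
      tendsto_const_nhds.prodMk_nhds tendsto_id
    filter_upwards [t.eventually (hUP hx).2.2.2] with x' e using e.symm
  have hcont : ContinuousOn f U := fun x hx => by
    refine ContinuousAt.continuousWithinAt (ContinuousAt.congr ?_ (heq x hx))
    have c1 : ContinuousAt (fun x' => κ (x, x')) x :=
      ContinuousAt.comp (f := fun x' : E => (x, x'))
        ((hκs 0).continuousOn.continuousAt (hW.mem_nhds (hWU x hx))) (by fun_prop)
    have c2 : ContinuousAt (fun x' => f (κ (x, x'))) x :=
      ContinuousAt.comp (f := fun x' : E => κ (x, x')) (by rwa [hκ0 x hx]) c1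
    refine ContinuousAt.comp (f := fun x' : E => (f x, f (κ (x, x')))) ?_
      (continuousAt_const.prodMk c2)
    rw [hκ0 x hx, hf0]
    exact (hm's 0).continuousOn.continuousAt (hW'.mem_nhds (hW'U x hx))
  refine ⟨U, hU, h0U, fun k => ?_⟩
  induction k with
  | zero => exact hcont
  | succ k ih =>
    obtain ⟨-, dκ, hdκ, hdκk⟩ := hκs (k + 1)
    obtain ⟨-, dm, hdm, hdmk⟩ := hm's (k + 1)
    have hOW' : IsOpen (W' ×ˢ (univ : Set (F × F))) := hW'.prod isOpen_univ
    -- The chain rule for `x' ↦ f x * f (x⁻¹ x')` at `x' = x`. The formula contains `f` but no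
    -- derivative of it other than `L`, so it is `C^k` as soon as `f` is.
    refine ⟨hcont, fun z => dm ((f z.1, 0), (0, L (dκ ((z.1, z.1), (0, z.2))))),
      fun x hx y => ?_, ?_⟩
    · have d1 : HasDirDeriv (fun x' => κ (x, x')) x y (dκ ((x, x), (0, y))) := by
        simpa [HasDirDeriv] using hdκ (x, x) (hWU x hx) (0, y)
      have d2 : HasDirDeriv (fun x' => f (κ (x, x'))) x y (L (dκ ((x, x), (0, y)))) := by
        -- The remainder `f - L` along `t ↦ κ (x, x + t • y)` is negligible, this curve being `t`
        -- times a convergent difference quotient.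
        have e1 := (hL.tendsto_inv_smul hβ (tendsto_id.mono_left nhdsWithin_le_nhds) d1).add
          ((L.continuous.tendsto _).comp d1)
        rw [zero_add] at e1
        refine e1.congr' ?_
        filter_upwards [self_mem_nhdsWithin] with t ht
        have ht' : t ≠ 0 := ht
        simp only [hκ0 x hx, hf0, sub_zero, id, smul_smul, mul_inv_cancel₀ ht', one_smul,
          Function.comp_apply, smul_sub, map_smul, sub_add_cancel]
      have d3 : HasDirDeriv (fun x' => (f x, f (κ (x, x')))) x y
          (0, L (dκ ((x, x), (0, y)))) := by
        refine Tendsto.congr (fun t => ?_) ((tendsto_const_nhds (x := (0 : F))).prodMk_nhds d2)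
        simp
      have hx' : (f x, f (κ (x, x))) = (f x, 0) := by rw [hκ0 x hx, hf0]
      have d4 := hasDirDeriv_comp hW' hdm (h := fun x' => (f x, f (κ (x, x'))))
        (by rw [hx']; exact hW'U x hx)
        (hdmk.continuousOn.continuousAt
          (hOW'.mem_nhds ⟨by rw [hx']; exact hW'U x hx, mem_univ _⟩)) d3
      rw [hx'] at d4
      exact d4.congr_nhds (heq x hx)
    · have s1 : IsCkOn k (U ×ˢ univ) (fun z : E × E => f z.1) := by
        have := ih.comp_affine (ContinuousLinearMap.fst ℝ E E) 0
        simp only [add_zero, ContinuousLinearMap.coe_fst'] at this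
        exact this.mono fun z hz => hz.1
      have s2 : IsCkOn k (U ×ˢ univ) (fun z : E × E => dκ ((z.1, z.1), (0, z.2))) := by
        have := hdκk.comp_affine
          (((ContinuousLinearMap.fst ℝ E E).prod (ContinuousLinearMap.fst ℝ E E)).prod
            ((0 : E × E →L[ℝ] E).prod (ContinuousLinearMap.snd ℝ E E))) 0
        simp only [add_zero] at this
        exact this.mono fun z hz => ⟨hWU _ hz.1, mem_univ _⟩
      have s3 : IsCkOn k (U ×ˢ univ) (fun z : E × E => L (dκ ((z.1, z.1), (0, z.2)))) := by
        simpa using s2.affine_comp L 0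
      exact IsCkOn.comp hOW' hdmk ((s1.prodMk (isCkOn_const 0)).prodMk
        ((isCkOn_const 0).prodMk s3)) fun z hz => ⟨hW'U _ hz.1, mem_univ _⟩

/-- A Hölder continuous local homomorphism to a local Lie group modelled on a Mackey complete space
is smooth near `0`. -/
theorem IsLocalLieGroup.isSmoothNear_of_isBigOPow [T2Space E] [T2Space F] (h : IsLocalLieGroup m ι)
    (h' : IsLocalLieGroup m' ι') (hF : IsMackeyComplete F) (hf0 : f 0 = 0)
    (hf : ∀ᶠ z : E × E in 𝓝 0, f (m z) = m' (f z.1, f z.2))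
    {α : ℝ} (hα : 0 < α) (hO : IsBigOPow α f) : IsSmoothNear f 0 := by
  have hA := fun γ (hγ : 0 < γ) (hO : IsBigOPow γ f) => h.isBigOPow_almost_additive h' hf hγ hO
  have h34 : IsBigOPow (3 / 4) f := hO.improve hα fun γ hγ hOγ =>
    (hA γ hγ hOγ).sub_two_smul (by positivity)
  obtain ⟨L, hL⟩ := exists_clm_of_almost_additive hF (by norm_num) (β := 2 * (3 / 4)) (by norm_num)
    h34 (hA _ (by norm_num) h34)
  have hfc : ContinuousAt f 0 := by
    have := hO.tendsto hα
    rwa [ContinuousAt, hf0]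
  exact h.isSmoothNear_of_hom h' hf0 hfc hf (by norm_num) hL

end LocalGroup

/-! ### Charts translated to the origin. -/

section CenteredChart

variable {E M : Type*} [AddGroup E] [TopologicalSpace E] [TopologicalSpace M]

theorem eventually_centered_left_inv {φ : OpenPartialHomeomorph M E} {g : M}
    (hg : g ∈ φ.source) : ∀ᶠ h in 𝓝 g, φ.symm (φ h - φ g + φ g) = h := by
  filter_upwards [φ.open_source.mem_nhds hg] with h hh
  rw [sub_add_cancel, φ.left_inv hh]

variable [ContinuousAdd E]

theorem tendsto_centered_symm {φ : OpenPartialHomeomorph M E} {g : M} (hg : g ∈ φ.source) :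
    Tendsto (fun x => φ.symm (x + φ g)) (𝓝 0) (𝓝 g) := by
  have h1 : Tendsto (fun x => x + φ g) (𝓝 0) (𝓝 (φ g)) :=
    Continuous.tendsto' (by fun_prop) _ _ (zero_add _)
  have h2 := φ.continuousAt_symm (φ.map_source hg)
  rw [ContinuousAt, φ.left_inv hg] at h2
  exact h2.comp h1

theorem eventually_centered_right_inv {φ : OpenPartialHomeomorph M E} {g : M}
    (hg : g ∈ φ.source) : ∀ᶠ x in 𝓝 (0 : E), φ (φ.symm (x + φ g)) - φ g = x := by
  have h1 : Tendsto (fun x => x + φ g) (𝓝 0) (𝓝 (φ g)) :=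
    Continuous.tendsto' (by fun_prop) _ _ (zero_add _)
  filter_upwards [h1.eventually (φ.open_target.mem_nhds (φ.map_source hg))] with x hx
  rw [φ.right_inv hx, add_sub_cancel_right]

end CenteredChart

/-! ### From Lie groups to local groups, and back by translation. -/

section LieGroups

variable {E : Type*} [AddCommGroup E] [Module ℝ E] [TopologicalSpace E]
variable {F : Type*} [AddCommGroup F] [Module ℝ F] [TopologicalSpace F]

theorem isOpen_localDomain {X Y M N : Type*} [TopologicalSpace X] [TopologicalSpace Y]
    [TopologicalSpace M] [TopologicalSpace N] (φ : OpenPartialHomeomorph M X)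
    (ψ : OpenPartialHomeomorph N Y) {f : M → N} (hf : Continuous f) :
    IsOpen (localDomain φ ψ f) :=
  φ.isOpen_image_of_subset_source ((ψ.open_source.preimage hf).inter φ.open_source)
    inter_subset_right

theorem IsSmoothMap.isSmoothNear {M N : Type*} [TopologicalSpace M] [ChartedSpace E M]
    [TopologicalSpace N] [ChartedSpace F N] {f : M → N} (hf : IsSmoothMap E F f)
    {φ : OpenPartialHomeomorph M E} {ψ : OpenPartialHomeomorph N F} (hφ : IsChart φ)
    (hψ : IsChart ψ) {x : M} (hx : x ∈ φ.source) (hfx : f x ∈ ψ.source) :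
    IsSmoothNear (fun z => ψ (f (φ.symm z))) (φ x) :=
  ⟨_, isOpen_localDomain φ ψ hf.1, ⟨x, ⟨hfx, hx⟩, rfl⟩, hf.2 φ ψ hφ hψ⟩

theorem IsHolderOn.isHolderAt {α : ℝ} {U : Set E} {f : E → F} (h : IsHolderOn α U f) {x : E}
    (hx : x ∈ U) : IsHolderAt α U f x := by
  intro q hq
  obtain ⟨p, hp, δ, hδ, hU, H⟩ := h x hx q hq
  exact ⟨δ, hδ, 1, one_pos, p, hp, hU, fun y hy => by
    simpa using H x (p.mem_ball_self hδ) y hy⟩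

theorem IsHolderMap.isHolderMapAt {M N : Type*} [TopologicalSpace M] [ChartedSpace E M]
    [TopologicalSpace N] [ChartedSpace F N] {α : ℝ} {f : M → N} (h : IsHolderMap E F α f) (x : M) :
    IsHolderMapAt E F α f x := by
  obtain ⟨φ, ψ, hφ, hψ, hx, hfx, H⟩ := h.2 x
  exact ⟨h.1.continuousAt, φ, ψ, hφ, hψ, hx, hfx, H.isHolderAt ⟨x, ⟨hfx, hx⟩, rfl⟩⟩

variable {G : Type*} [Group G] [TopologicalSpace G] [ChartedSpace E G]
variable {H : Type*} [Group H] [TopologicalSpace H] [ChartedSpace F H]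

theorem IsLieGroup.isTopologicalGroup (hG : IsLieGroup E G) : IsTopologicalGroup G where
  continuous_mul := hG.continuous_mul
  continuous_inv := hG.smooth_inv.1

theorem IsLieGroup.isSmoothNear_mul (hG : IsLieGroup E G) {φ₁ φ₂ ψ : OpenPartialHomeomorph G E}
    (h₁ : IsChart φ₁) (h₂ : IsChart φ₂) (hψ : IsChart ψ) {g₁ g₂ : G} (hg₁ : g₁ ∈ φ₁.source)
    (hg₂ : g₂ ∈ φ₂.source) (hg : g₁ * g₂ ∈ ψ.source) :
    IsSmoothNear (fun z : E × E => ψ (φ₁.symm z.1 * φ₂.symm z.2)) (φ₁ g₁, φ₂ g₂) :=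
  ⟨_, isOpen_localDomain (φ₁.prod φ₂) ψ hG.continuous_mul,
    ⟨(g₁, g₂), ⟨hg, hg₁, hg₂⟩, rfl⟩, hG.smooth_mul φ₁ φ₂ ψ h₁ h₂ hψ⟩

section LocalGroup

variable [IsTopologicalAddGroup E] [ContinuousSMul ℝ E] [LocallyConvexSpace ℝ E]

/-- A chart around the identity, translated to be centered at `0`, turns a Lie group into a local
Lie group. -/
theorem IsLieGroup.isLocalLieGroup (hG : IsLieGroup E G) {φ : OpenPartialHomeomorph G E}
    (hφ : IsChart φ) (h1 : (1 : G) ∈ φ.source) :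
    IsLocalLieGroup (fun z : E × E => φ (φ.symm (z.1 + φ 1) * φ.symm (z.2 + φ 1)) - φ 1)
      (fun x => φ (φ.symm (x + φ 1))⁻¹ - φ 1) := by
  have := hG.isTopologicalGroup
  have ti := tendsto_centered_symm h1
  have ci := eventually_centered_right_inv h1
  have ic := eventually_centered_left_inv h1
  have i0 : φ.symm (0 + φ 1) = 1 := by rw [zero_add, φ.left_inv h1]
  have tinv : Tendsto (fun x => (φ.symm (x + φ 1))⁻¹) (𝓝 0) (𝓝 (1 : G)) := by
    simpa using ti.inv
  have t1 : Tendsto (fun z : (E × E) × E => z.1.1) (𝓝 0) (𝓝 0) :=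
    Continuous.tendsto' (by fun_prop) _ _ rfl
  have t2 : Tendsto (fun z : (E × E) × E => z.1.2) (𝓝 0) (𝓝 0) :=
    Continuous.tendsto' (by fun_prop) _ _ rfl
  have t3 : Tendsto (fun z : (E × E) × E => z.2) (𝓝 0) (𝓝 0) :=
    Continuous.tendsto' (by fun_prop) _ _ rfl
  refine ⟨?_, ?_, ?_, ?_, ?_, ?_, ?_, ?_⟩
  · refine IsSmoothNear.sub (IsSmoothNear.comp_of_eq
      (f := fun z : E × E => (z.1 + φ 1, z.2 + φ 1))
      (hG.isSmoothNear_mul hφ hφ hφ h1 h1 (by simpa using h1))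
      (((isSmoothNear_fst _).add (isSmoothNear_const _ _)).prodMk
        ((isSmoothNear_snd _).add (isSmoothNear_const _ _))) (by simp)) (isSmoothNear_const _ _)
  · exact IsSmoothNear.sub (IsSmoothNear.comp_of_eq (f := fun z : E => z + φ 1)
      (hG.smooth_inv.isSmoothNear hφ hφ h1 (by simpa using h1))
      ((isSmoothNear_id _).add (isSmoothNear_const _ _)) (by simp)) (isSmoothNear_const _ _)
  · rw [i0, inv_one, sub_self]
  · filter_upwards [ci] with x hx
    simpa only [i0, mul_one] using hx
  · filter_upwards [ci] with x hx
    simpa only [i0, one_mul] using hx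
  · filter_upwards [tinv.eventually ic] with x hx
    rw [hx, inv_mul_cancel, sub_self]
  · filter_upwards [tinv.eventually ic] with x hx
    rw [hx, mul_inv_cancel, sub_self]
  · have t12 := (ti.comp t1).mul (ti.comp t2)
    have t23 := (ti.comp t2).mul (ti.comp t3)
    rw [one_mul] at t12 t23
    filter_upwards [t12.eventually ic, t23.eventually ic] with z e1 e2
    simp only [Function.comp_apply] at e1 e2
    simp only [e1, e2, mul_assoc]

end LocalGroup

variable [IsTopologicalAddGroup E] [ContinuousSMul ℝ E] [LocallyConvexSpace ℝ E] [T2Space E]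
variable [IsTopologicalAddGroup F] [ContinuousSMul ℝ F] [LocallyConvexSpace ℝ F] [T2Space F]

/-- A homomorphism between Lie groups which is Hölder continuous at `1` is smooth near `1`, in
centered charts. -/
theorem IsLieGroup.isSmoothNear_of_isHolderAt (hG : IsLieGroup E G) (hH : IsLieGroup F H)
    (hF : IsMackeyComplete F) (f : G →* H) (hfc : ContinuousAt f 1) {α : ℝ} (hα : 0 < α)
    {φ : OpenPartialHomeomorph G E} {ψ : OpenPartialHomeomorph H F} (hφ : IsChart φ)
    (hψ : IsChart ψ) (h1 : (1 : G) ∈ φ.source) (h1' : (1 : H) ∈ ψ.source)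
    (hf : IsHolderAt α (localDomain φ ψ f) (ψ ∘ f ∘ φ.symm) (φ 1)) :
    IsSmoothNear (fun x => ψ (f (φ.symm (x + φ 1))) - ψ 1) 0 := by
  have := hG.isTopologicalGroup
  have := hH.isTopologicalGroup
  have ti := tendsto_centered_symm h1
  have hfc' : Tendsto f (𝓝 1) (𝓝 1) := by simpa using hfc.tendsto
  have t1 : Tendsto (fun z : E × E => z.1) (𝓝 0) (𝓝 0) := continuous_fst.tendsto' _ _ rfl
  have t2 : Tendsto (fun z : E × E => z.2) (𝓝 0) (𝓝 0) := continuous_snd.tendsto' _ _ rfl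
  refine (hG.isLocalLieGroup hφ h1).isSmoothNear_of_isBigOPow (hH.isLocalLieGroup hψ h1') hF
    ?_ ?_ hα ?_
  · simp [φ.left_inv h1]
  · have t12 := (ti.comp t1).mul (ti.comp t2)
    rw [one_mul] at t12
    filter_upwards [t12.eventually (eventually_centered_left_inv h1),
      (hfc'.comp (ti.comp t1)).eventually (eventually_centered_left_inv h1'),
      (hfc'.comp (ti.comp t2)).eventually (eventually_centered_left_inv h1')] with z e1 e2 e3
    simp only [Function.comp_apply] at e1 e2 e3
    simp only [e1, e2, e3, map_mul]
  · refine .of_le hα fun q hq => ?_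
    obtain ⟨δ, hδ, C, -, p, hp, -, hle⟩ := hf q hq
    refine ⟨δ, hδ, C, p, hp, fun x hx => ?_⟩
    have := hle (x + φ 1) (by rwa [Seminorm.mem_ball, add_sub_cancel_right])
    simpa [φ.left_inv h1] using this

/-- Near `g`, `f h = f g * f (g⁻¹ * h)` with `g⁻¹ * h` near `1`, so smoothness near `1` spreads by
translations. -/
theorem IsLieGroup.isSmoothMap_of_isHolderMapAt (hG : IsLieGroup E G) (hH : IsLieGroup F H)
    (hF : IsMackeyComplete F) (f : G →* H) {α : ℝ} (hα : 0 < α)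
    (hf : IsHolderMapAt E F α f 1) : IsSmoothMap E F f := by
  have := hG.isTopologicalGroup
  have := hH.isTopologicalGroup
  obtain ⟨hfc, φ, ψ, hφ, hψ, h1, h1', hO⟩ := hf
  rw [map_one] at h1'
  have hcont : Continuous f := continuous_of_continuousAt_one f hfc
  have hs := hG.isSmoothNear_of_isHolderAt hH hF f hfc hα hφ hψ h1 h1' hO
  refine ⟨hcont, fun φ' ψ' hφ' hψ' => isSmoothOn_of_forall ?_⟩
  rintro _ ⟨g, ⟨hfg, hg⟩, rfl⟩
  have hfg' : f g ∈ ψ'.source := hfg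
  -- Smoothness of multiplication is stated in charts for both factors, so the constant factor `g⁻¹`
  -- also has to be read in one.
  set χ := chartAt E g⁻¹ with hχ
  have hχs : g⁻¹ ∈ χ.source := mem_chart_source E _
  have hχc : IsChart χ := hG.smooth_atlas _ (chart_mem_atlas E _)
  have s1 : IsSmoothNear (fun z : E => φ (χ.symm (χ g⁻¹) * φ'.symm z) - φ 1) (φ' g) :=
    (IsSmoothNear.comp (f := fun z : E => (χ g⁻¹, z))
      (hG.isSmoothNear_mul hχc hφ' hφ hχs hg (by simpa using h1))
      ((isSmoothNear_const _ _).prodMk (isSmoothNear_id _))).sub (isSmoothNear_const _ _)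
  have s2 : IsSmoothNear (fun z : E => ψ (f (φ.symm (φ (χ.symm (χ g⁻¹) * φ'.symm z) - φ 1 + φ 1)))
      - ψ 1 + ψ 1) (φ' g) :=
    (IsSmoothNear.comp_of_eq hs s1 (by simp [χ.left_inv hχs, φ'.left_inv hg])).add
      (isSmoothNear_const _ _)
  have s3 : IsSmoothNear (fun z : E => ψ' (ψ'.symm (ψ' (f g)) *
      ψ.symm (ψ (f (φ.symm (φ (χ.symm (χ g⁻¹) * φ'.symm z) - φ 1 + φ 1))) - ψ 1 + ψ 1))) (φ' g) :=
    IsSmoothNear.comp_of_eq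
      (g := fun w : F × F => ψ' (ψ'.symm w.1 * ψ.symm w.2))
      (hH.isSmoothNear_mul hψ' hψ hψ' hfg' h1' (by simpa using hfg'))
      ((isSmoothNear_const (ψ' (f g)) _).prodMk s2)
      (by simp [χ.left_inv hχs, φ'.left_inv hg, φ.left_inv h1])
  refine s3.congr ?_
  have tφ' : Tendsto φ'.symm (𝓝 (φ' g)) (𝓝 g) := by
    have := φ'.continuousAt_symm (φ'.map_source hg)
    rwa [ContinuousAt, φ'.left_inv hg] at this
  have t1 : Tendsto (fun z => g⁻¹ * φ'.symm z) (𝓝 (φ' g)) (𝓝 1) := by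
    simpa using tφ'.const_mul g⁻¹
  have t2 : Tendsto (fun z => f (g⁻¹ * φ'.symm z)) (𝓝 (φ' g)) (𝓝 1) := by
    simpa only [map_one] using! (hcont.tendsto 1).comp t1
  filter_upwards [t1.eventually (φ.open_source.mem_nhds h1),
    t2.eventually (ψ.open_source.mem_nhds h1')] with z e1 e2
  simp only [χ.left_inv hχs, ψ'.left_inv hfg', sub_add_cancel, φ.left_inv e1, ψ.left_inv e2,
    Function.comp_apply]
  rw [map_mul, map_inv, mul_inv_cancel_left]

end LieGroups

end Bastiani

theorem mainTheorem1
    {E : Type*} [AddCommGroup E] [Module ℝ E] [TopologicalSpace E] [IsTopologicalAddGroup E]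
    [ContinuousSMul ℝ E] [T2Space E] [LocallyConvexSpace ℝ E]
    {F : Type*} [AddCommGroup F] [Module ℝ F] [TopologicalSpace F] [IsTopologicalAddGroup F]
    [ContinuousSMul ℝ F] [T2Space F] [LocallyConvexSpace ℝ F]
    {G : Type*} [Group G] [TopologicalSpace G] [ChartedSpace E G]
    {H : Type*} [Group H] [TopologicalSpace H] [ChartedSpace F H]
    (hG : Bastiani.IsLieGroup E G) (hH : Bastiani.IsLieGroup F H)
    (hF : Bastiani.IsMackeyComplete F) (f : G →* H) :
    ((∃ α : ℝ, 0 < α ∧ α ≤ 1 ∧ Bastiani.IsHolderMapAt E F α f 1) → Bastiani.IsSmoothMap E F f) ∧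
    (Bastiani.IsHolderMapAt E F 1 f 1 → Bastiani.IsSmoothMap E F f) ∧
    (Bastiani.IsHolderMap E F 1 f → Bastiani.IsSmoothMap E F f) := by
  refine ⟨?_, fun hf => ?_, fun hf => ?_⟩
  · rintro ⟨α, hα, -, hf⟩
    exact hG.isSmoothMap_of_isHolderMapAt hH hF f hα hf
  · exact hG.isSmoothMap_of_isHolderMapAt hH hF f one_pos hf
  · exact hG.isSmoothMap_of_isHolderMapAt hH hF f one_pos (hf.isHolderMapAt 1)
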